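/- Let $X$ be a locally compact Hausdorff space, $U\subseteq X$ an open subset and $\sigma\colon U\to X$ a local homeomorphism; write $\Sigma=(X,\sigma)$. Let $\sigma^0=\mathrm{id}_X$ and let $\sigma^{n+1}=\sigma\circ\sigma^n$ be defined on $\{x\in\operatorname{dom}\sigma^n : \sigma^n(x)\in U\}$; every equation between iterates includes the claim that both sides are defined. Let $C^*(\Sigma)$ be the universal C*-algebra generated by the images of a $*$-homomorphism $t^0\colon C_0(X)\to C^*(\Sigma)$ and a linear map $t^1\colon C_c(U)\to C^*(\Sigma)$ such that - $t^1(\xi)^*t^1(\eta)=t^0(\langle\xi,\eta\rangle)$ for $\xi,\eta\in C_c(U)$, where $\langle\xi,\eta\rangle(x)=\sum_{\sigma(y)=x}\overline{\xi(y)}\,\eta(y)$; - $t^1(\xi)t^1(\eta)^*=t^0(\xi\overline{\eta})$ for $\xi,\eta\in C_c(V)$, whenever $V\subseteq U$ is open and $\sigma$ is injective on $V$. For $x_0\in X$ let $\operatorname{Orb}(x_0)=\{x\in X : \sigma^n(x)=\sigma^m(x_0)\text{ for some }n,m\in\mathbb N\}$, and let $H_{x_0}$ be the Hilbert space with orthonormal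 basis $(\delta_x)_{x\in\operatorname{Orb}(x_0)}$. For $\gamma\in\mathbb T$ let $\pi_{(x_0,\gamma)}\colon C^*(\Sigma)\to B(H_{x_0})$ be the representation with $$\pi_{(x_0,\gamma)}(t^0(f))\delta_x=f(x)\delta_x,\qquad \pi_{(x_0,\gamma)}(t^1(\xi))\delta_x=\gamma\sum_{\sigma(y)=x}\xi(y)\delta_y,$$ and let $P_{(x_0,\gamma)}=\ker\pi_{(x_0,\gamma)}$. For a closed two-sided ideal $I$ of $C^*(\Sigma)$ put $$Y_I=\{(x,\gamma)\in X\times\mathbb T : I\subseteq P_{(x,\gamma)}\}.$$ A point $x\in X$ is periodic if $\sigma^{k+n}(x)=\sigma^k(x)$ for some $k\ge 0$ and $n\ge 1$. In that case $p(x)$ is the smallest $n\ge1$ for which such a $k$ exists, and $l(x)$ is the smallest $k\geq 0$ with $\sigma^{k+p(x)}(x)=\sigma^k(x)$; otherwise $p(x)=l(x)=\infty$. For $Y\subseteq X\times\mathbb T$ write $Y_x=\{\gamma\in\mathbb T : (x,\gamma)\in Y\}$. The set $Y$ is called admissible if 1. $Y$ is closed in $X\times\mathbb T$; 2. $Y_x=Y_{\sigma(x)}$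 for all $x\in U$; 3. whenever $Y_{x_0}\ne\emptyset$ and $Y_{x_0}\neq\mathbb T$, the point $x_0$ is periodic, $e^{2\pi i/p(x_0)}\,Y_{x_0}=Y_{x_0}$, and there is a neighbourhood $V$ of $x_0$ such that $Y_x=\emptyset$ for all $x\in V$ with $l(x)\ne l(x_0)$. **Proposition.** For every closed two-sided ideal $I$ of $C^*(\Sigma)$, the set $Y_I$ is admissible. -/

import Mathlib

universe u v w

open Topology
open scoped ZeroAtInfty CompactlySupported ENNReal Pointwise

set_option linter.unusedSectionVars false

noncomputable section

/-! ### Summation over the fibres of a local homeomorphism -/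

section FiberSum

variable {Y : Type v} {X : Type u} [TopologicalSpace Y] [TopologicalSpace X]

/-- The function `x ↦ ∑_{φ(y) = x} g(y)`. -/
def fiberSum (φ : Y → X) (g : Y → ℂ) (x : X) : ℂ :=
  ∑ᶠ (y : Y) (_ : φ y = x), g y

/-- A compactly supported function has only finitely many non-zero values on each fibre. -/
theorem fiberSum_finite {φ : Y → X} (hφ : IsLocalHomeomorph φ) {g : Y → ℂ}
    (hg : HasCompactSupport g) (x : X) : {y | φ y = x ∧ g y ≠ 0}.Finite := by
  have hl := hφ.isLocallyInjective
  choose W hWo hyW hWi using hl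
  obtain ⟨t, ht⟩ := hg.isCompact.elim_finite_subcover W hWo
    (fun y _ => Set.mem_iUnion.2 ⟨y, hyW y⟩)
  have hsub : {y | φ y = x ∧ g y ≠ 0} ⊆ ⋃ i ∈ t, {y | y ∈ W i ∧ φ y = x} := by
    rintro y ⟨hy, hgy⟩
    obtain ⟨i, hi, hyi⟩ := Set.mem_iUnion₂.1 (ht (subset_tsupport g hgy))
    exact Set.mem_iUnion₂.2 ⟨i, hi, hyi, hy⟩
  refine Set.Finite.subset (Set.Finite.biUnion t.finite_toSet fun i _ => ?_) hsub
  refine Set.Subsingleton.finite ?_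
  rintro a ⟨ha, hax⟩ b ⟨hb, hbx⟩
  exact hWi i ha hb (hax.trans hbx.symm)

theorem fiberSum_sum {φ : Y → X} (hφ : IsLocalHomeomorph φ) {ι : Type*} (s : Finset ι)
    (g : ι → Y → ℂ) (hg : ∀ i, HasCompactSupport (g i)) (x : X) :
    fiberSum φ (fun y => ∑ i ∈ s, g i y) x = ∑ i ∈ s, fiberSum φ (g i) x := by
  have hfin : ∀ i, {y | φ y = x ∧ g i y ≠ 0}.Finite := fun i => fiberSum_finite hφ (hg i) x
  have hbig : (⋃ i ∈ s, {y | φ y = x ∧ g i y ≠ 0}).Finite :=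
    Set.Finite.biUnion s.finite_toSet fun i _ => hfin i
  have key : ∀ h : Y → ℂ, (∀ y, φ y = x → h y ≠ 0 → y ∈ hbig.toFinset) →
      fiberSum φ h x = ∑ y ∈ hbig.toFinset, h y := by
    intro h hh
    have hmem : ∀ y ∈ hbig.toFinset, φ y = x := by
      intro y hy
      rw [Set.Finite.mem_toFinset, Set.mem_iUnion₂] at hy
      obtain ⟨i, _, hy, _⟩ := hy
      exact hy
    unfold fiberSum
    classical
    rw [finsum_eq_sum_of_support_subset (s := hbig.toFinset)]
    · refine Finset.sum_congr rfl fun y hy => ?_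
      rw [finsum_eq_if, if_pos (hmem y hy)]
    · intro y hy
      rw [Function.mem_support, finsum_eq_if] at hy
      by_cases h1 : φ y = x
      · rw [if_pos h1] at hy
        exact hh y h1 hy
      · rw [if_neg h1] at hy
        exact absurd rfl hy
  rw [key _ ?_, Finset.sum_comm]
  · refine Finset.sum_congr rfl fun i hi => ?_
    rw [key]
    intro y h1 h2
    rw [Set.Finite.mem_toFinset]
    exact Set.mem_iUnion₂.2 ⟨i, hi, h1, h2⟩
  · intro y h1 h2
    obtain ⟨i, hi, h3⟩ := Finset.exists_ne_zero_of_sum_ne_zero h2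
    rw [Set.Finite.mem_toFinset]
    exact Set.mem_iUnion₂.2 ⟨i, hi, h1, h3⟩

variable [T2Space X]

theorem fiberSum_support_subset (φ : Y → X) (g : Y → ℂ) :
    Function.support (fiberSum φ g) ⊆ φ '' tsupport g := by
  intro x hx
  by_contra hcon
  refine hx ?_
  unfold fiberSum
  refine finsum_eq_zero_of_forall_eq_zero fun y => ?_
  classical
  rw [finsum_eq_if]
  split_ifs with hy
  · by_contra hgy
    exact hcon ⟨y, subset_tsupport g hgy, hy⟩
  · rfl

theorem fiberSum_hasCompactSupport {φ : Y → X} (hφ : Continuous φ) {g : Y → ℂ}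
    (hg : HasCompactSupport g) : HasCompactSupport (fiberSum φ g) :=
  HasCompactSupport.of_support_subset_isCompact (hg.isCompact.image hφ)
    (fiberSum_support_subset φ g)

theorem fiberSum_continuous_of_subset (e : OpenPartialHomeomorph Y X) (he : Continuous e)
    {g : Y → ℂ} (hg : Continuous g) (hc : HasCompactSupport g) (hsub : tsupport g ⊆ e.source) :
    Continuous (fiberSum e g) := by
  have hval : ∀ x ∈ e.target, fiberSum e g x = g (e.symm x) := by
    intro x hx
    unfold fiberSum
    classical
    rw [finsum_eq_single _ (e.symm x)]
    · rw [finsum_eq_if, if_pos (e.right_inv hx)]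
    · intro y hy
      rw [finsum_eq_if]
      split_ifs with hyx
      · by_contra hgy
        have hys : y ∈ e.source := hsub (subset_tsupport g hgy)
        exact hy (by rw [← hyx, e.left_inv hys])
      · rfl
  have hcont : ContinuousOn (fiberSum e g) e.target :=
    (hg.comp_continuousOn e.continuousOn_symm).congr hval
  refine continuous_of_tsupport fun x hx => ?_
  have hK : IsClosed (e '' tsupport g) := (hc.isCompact.image he).isClosed
  obtain ⟨y, hy, rfl⟩ := (closure_minimal (fiberSum_support_subset e g) hK) hx
  exact hcont.continuousAt (e.open_target.mem_nhds (e.map_source (hsub hy)))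

/-- Summing a function in `C_c` over the fibres of a local homeomorphism gives a continuous
function. -/
theorem fiberSum_continuous [T2Space Y] [LocallyCompactSpace Y] {φ : Y → X}
    (hφ : IsLocalHomeomorph φ) {g : Y → ℂ} (hg : Continuous g) (hc : HasCompactSupport g) :
    Continuous (fiberSum φ g) := by
  choose e hye hφe using hφ
  obtain ⟨t, ht⟩ := hc.isCompact.elim_finite_subcover (fun y => (e y).source)
    (fun y => (e y).open_source) (fun y _ => Set.mem_iUnion.2 ⟨y, hye y⟩)
  obtain ⟨ρ, hρs, hρ1, -, hρc⟩ := exists_continuous_sum_one_of_isOpen_isCompact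
    (s := fun i : Fin t.card => (e (t.equivFin.symm i)).source)
    (fun i => (e _).open_source) hc.isCompact (by
      intro y hy
      obtain ⟨i, hi, hyi⟩ := Set.mem_iUnion₂.1 (ht hy)
      exact Set.mem_iUnion.2 ⟨t.equivFin ⟨i, hi⟩, by simpa using hyi⟩)
  have hdec : g = fun y => ∑ i : Fin t.card, (ρ i y : ℂ) * g y := by
    funext y
    rw [← Finset.sum_mul]
    by_cases hy : y ∈ tsupport g
    · have h1 := hρ1 hy
      rw [Finset.sum_apply, Pi.one_apply] at h1
      rw [← Complex.ofReal_sum, h1, Complex.ofReal_one, one_mul]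
    · rw [image_eq_zero_of_notMem_tsupport hy, mul_zero]
  have hci : ∀ i, HasCompactSupport fun y => (ρ i y : ℂ) * g y := fun i => hc.mul_left
  have hsum : fiberSum φ g = fun x => ∑ i : Fin t.card, fiberSum φ (fun y => (ρ i y : ℂ) * g y) x := by
    funext x
    conv_lhs => rw [hdec]
    exact fiberSum_sum (fun y => ⟨e y, hye y, hφe y⟩) _ _ hci x
  rw [hsum]
  refine continuous_finsetSum _ fun i _ => ?_
  have hcφ : Continuous φ := IsLocalHomeomorph.continuous (fun y => ⟨e y, hye y, hφe y⟩)
  have hφi := hφe (t.equivFin.symm i)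
  have := fiberSum_continuous_of_subset (e (t.equivFin.symm i)) (hφi ▸ hcφ)
    (g := fun y => (ρ i y : ℂ) * g y)
    ((Complex.continuous_ofReal.comp (ρ i).continuous).mul hg) (hci i) (by
      refine Set.Subset.trans (closure_mono ?_) (hρs i)
      intro y hy h0
      refine hy ?_
      show (ρ i y : ℂ) * g y = 0
      rw [h0, Complex.ofReal_zero, zero_mul])
  rwa [← hφi] at this

end FiberSum

/-! ### Singly generated dynamical systems -/

/-- A singly generated dynamical system: a local homeomorphism `σ` from an open subset `U` of a
space `X` to `X`. -/
structure SGDS (X : Type u) [TopologicalSpace X] where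
  /-- the domain of `σ` -/
  U : TopologicalSpace.Opens X
  /-- the map -/
  σ : U → X
  isLocalHomeomorph : IsLocalHomeomorph σ

namespace SGDS

variable {X : Type u} [TopologicalSpace X]

section Dynamics

variable (S : SGDS X)

open Classical in
/-- `σ` as a partial function on `X`. -/
def step (x : X) : Option X := if h : x ∈ S.U then some (S.σ ⟨x, h⟩) else none

/-- The iterates of `σ`: `S.iter n x = some y` means that `x` is in the domain of `σⁿ` and
`σⁿ(x) = y`. -/
def iter : ℕ → X → Option X
  | 0, x => some x
  | n + 1, x => (iter n x).bind S.step

/-- `σᵃ(x) = σᵇ(y)`, both sides being defined. -/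
def IterEq (a : ℕ) (x : X) (b : ℕ) (y : X) : Prop :=
  ∃ z, S.iter a x = some z ∧ S.iter b y = some z

/-- The orbit of `x₀`. -/
def Orb (x₀ : X) : Set X := {x | ∃ n m : ℕ, S.IterEq n x m x₀}

/-- `x` is periodic: `σ^{k+n}(x) = σ^k(x)` for some `k` and some `n ≥ 1`. -/
def IsPeriodic (x : X) : Prop := ∃ k n : ℕ, 1 ≤ n ∧ S.IterEq (k + n) x k x

/-- The smallest `n ≥ 1` with `σ^{k+n}(x) = σ^k(x)` for some `k` (for periodic `x`). -/
def minPeriod (x : X) : ℕ := sInf {n | 1 ≤ n ∧ ∃ k, S.IterEq (k + n) x k x}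

/-- The smallest `k` with `σ^{k+p(x)}(x) = σ^k(x)` (for periodic `x`). -/
def minPreperiod (x : X) : ℕ := sInf {k | S.IterEq (k + S.minPeriod x) x k x}

open Classical in
/-- The period `p(x)`, which is `∞` for aperiodic `x`. -/
def period (x : X) : ℕ∞ := if S.IsPeriodic x then (S.minPeriod x : ℕ∞) else ⊤

open Classical in
/-- The preperiod `l(x)`, which is `∞` for aperiodic `x`. -/
def preperiod (x : X) : ℕ∞ := if S.IsPeriodic x then (S.minPreperiod x : ℕ∞) else ⊤

theorem iter_succ' (n : ℕ) (x : X) : S.iter (n + 1) x = (S.step x).bind (S.iter n) := by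
  induction n with
  | zero => simp [iter]
  | succ n ih =>
    rw [iter, ih, Option.bind_assoc]
    rfl

theorem step_of_mem {x : X} (h : x ∈ S.U) : S.step x = some (S.σ ⟨x, h⟩) := by
  simp [step, h]

theorem self_mem_orb (x₀ : X) : x₀ ∈ S.Orb x₀ := ⟨0, 0, x₀, rfl, rfl⟩

theorem map_mem_orb_iff {x₀ : X} (y : S.U) : S.σ y ∈ S.Orb x₀ ↔ (y : X) ∈ S.Orb x₀ := by
  have hs : ∀ n, S.iter (n + 1) (y : X) = S.iter n (S.σ y) := fun n => by
    rw [iter_succ', S.step_of_mem y.2]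
    rfl
  constructor
  · rintro ⟨n, m, z, hn, hm⟩
    exact ⟨n + 1, m, z, by rw [hs, hn], hm⟩
  · rintro ⟨n, m, z, hn, hm⟩
    cases n with
    | zero =>
      refine ⟨0, m + 1, S.σ y, rfl, ?_⟩
      have hz : (y : X) = z := Option.some.inj hn
      rw [iter, hm, ← hz]
      exact S.step_of_mem y.2
    | succ n => exact ⟨n, m, z, by rw [← hs, hn], hm⟩

end Dynamics

/-! ### Functions -/

section Functions

variable [T2Space X] [LocallyCompactSpace X] (S : SGDS X)

instance instLocallyCompactU : LocallyCompactSpace S.U := S.U.isOpen.locallyCompactSpace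

/-- The function `⟨ξ, η⟩(x) = ∑_{σ(y) = x} conj(ξ(y)) η(y)`, as an element of `C₀(X)`. -/
def ip (ξ η : C_c(S.U, ℂ)) : C₀(X, ℂ) where
  toFun := fiberSum S.σ fun y => star (ξ y) * η y
  continuous_toFun := fiberSum_continuous S.isLocalHomeomorph
    ((continuous_star.comp ξ.continuous).mul η.continuous) η.hasCompactSupport.mul_left
  zero_at_infty' := (fiberSum_hasCompactSupport S.isLocalHomeomorph.continuous
    η.hasCompactSupport.mul_left).is_zero_at_infty

theorem ip_apply (ξ η : C_c(S.U, ℂ)) (x : X) :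
    S.ip ξ η x = ∑ᶠ (y : S.U) (_ : S.σ y = x), star (ξ y) * η y := rfl

/-- The inclusion of `C_c(U)` in `C₀(X)`: extension by zero. -/
def extendZero (ξ : C_c(S.U, ℂ)) : C₀(X, ℂ) where
  toFun := Function.extend Subtype.val ξ 0
  continuous_toFun := HasCompactSupport.continuous_extend_zero S.U.isOpen ξ.continuous
    ξ.hasCompactSupport
  zero_at_infty' := (HasCompactSupport.extend_zero ξ.hasCompactSupport
    continuous_subtype_val).is_zero_at_infty

theorem extendZero_coe (ξ : C_c(S.U, ℂ)) (y : S.U) : S.extendZero ξ (y : X) = ξ y :=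
  Subtype.val_injective.extend_apply ξ 0 y

theorem extendZero_of_notMem (ξ : C_c(S.U, ℂ)) {x : X} (hx : x ∉ S.U) : S.extendZero ξ x = 0 :=
  Function.extend_apply' (f := (Subtype.val : S.U → X)) ξ 0 x (by
    rintro ⟨y, rfl⟩
    exact hx y.2)

end Functions

/-! ### The C*-algebra -/

section Universal

variable [T2Space X] [LocallyCompactSpace X] (S : SGDS X)

/-- A pair of a `*`-homomorphism `t⁰ : C₀(X) → B` and a linear map `t¹ : C_c(U) → B` into a
C*-algebra satisfying the defining relations of `C*(Σ)`. -/
structure Pair (B : Type v) [NonUnitalCStarAlgebra B] where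
  /-- the `*`-homomorphism on `C₀(X)` -/
  t0 : C₀(X, ℂ) →⋆ₙₐ[ℂ] B
  /-- the linear map on `C_c(U)` -/
  t1 : C_c(S.U, ℂ) →ₗ[ℂ] B
  star_t1_mul_t1 : ∀ ξ η : C_c(S.U, ℂ), star (t1 ξ) * t1 η = t0 (S.ip ξ η)
  t1_mul_star_t1 : ∀ V : Set S.U, IsOpen V → Set.InjOn S.σ V → ∀ ξ η : C_c(S.U, ℂ),
    tsupport ξ ⊆ V → tsupport η ⊆ V → t1 ξ * star (t1 η) = t0 (S.extendZero (ξ * star η))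

variable {S} in
theorem Pair.norm_t1_le {B : Type v} [NonUnitalCStarAlgebra B] (ρ : S.Pair B) (ξ : C_c(S.U, ℂ)) :
    ‖ρ.t1 ξ‖ ≤ Real.sqrt ‖S.ip ξ ξ‖ := by
  refine Real.le_sqrt_of_sq_le ?_
  rw [sq, ← CStarRing.norm_star_mul_self, ρ.star_t1_mul_t1]
  exact NonUnitalStarAlgHom.norm_apply_le ρ.t0 _

/-- All pairs with values in C*-algebras in the universe of `X`. -/
structure PairIndex where
  /-- the C*-algebra -/
  B : Type u
  [inst : NonUnitalCStarAlgebra B]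
  /-- the pair -/
  ρ : S.Pair B

instance instPairIndexAlg (i : S.PairIndex) : NonUnitalCStarAlgebra i.B := i.inst

/-- The C*-algebra of all bounded families indexed by the pairs. -/
abbrev Ambient : Type (u + 1) := lp (fun i : S.PairIndex => i.B) ∞

/-- The family `(t⁰_ρ(f))_ρ`. -/
def ambientT0 (f : C₀(X, ℂ)) : S.Ambient :=
  ⟨fun i => i.ρ.t0 f, memℓp_infty ⟨‖f‖, by
    rintro _ ⟨i, rfl⟩
    exact NonUnitalStarAlgHom.norm_apply_le i.ρ.t0 f⟩⟩

/-- The family `(t¹_ρ(ξ))_ρ`. -/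
def ambientT1 (ξ : C_c(S.U, ℂ)) : S.Ambient :=
  ⟨fun i => i.ρ.t1 ξ, memℓp_infty ⟨Real.sqrt ‖S.ip ξ ξ‖, by
    rintro _ ⟨i, rfl⟩
    exact i.ρ.norm_t1_le ξ⟩⟩

/-- The C*-subalgebra generated by the families `(t⁰_ρ(f))_ρ` and `(t¹_ρ(ξ))_ρ`. -/
def cstarSubalgebra : NonUnitalStarSubalgebra ℂ S.Ambient :=
  (NonUnitalStarAlgebra.adjoin ℂ
    (Set.range S.ambientT0 ∪ Set.range S.ambientT1)).topologicalClosure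

/-- The C*-algebra `C*(Σ)`: the C*-algebra generated by the family of all pairs. The C*-algebra
generated by the image of a pair has at most as many elements as there are sequences of
`*`-polynomials in elements of `C₀(X)` and `C_c(U)`, so the pairs with values in the universe of `X`
are all pairs up to isomorphism, and this algebra is the universal one; see `existsUnique_lift`. -/
def CStar : Type (u + 1) := S.cstarSubalgebra

instance instCStarAlg : NonUnitalCStarAlgebra S.CStar :=
  NonUnitalStarSubalgebra.nonUnitalCStarAlgebra S.cstarSubalgebra
    (h_closed := NonUnitalStarSubalgebra.isClosed_topologicalClosure _)

theorem ambientT0_mem (f : C₀(X, ℂ)) : S.ambientT0 f ∈ S.cstarSubalgebra :=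
  NonUnitalStarSubalgebra.le_topologicalClosure _
    (NonUnitalStarAlgebra.subset_adjoin ℂ _ (Or.inl ⟨f, rfl⟩))

theorem ambientT1_mem (ξ : C_c(S.U, ℂ)) : S.ambientT1 ξ ∈ S.cstarSubalgebra :=
  NonUnitalStarSubalgebra.le_topologicalClosure _
    (NonUnitalStarAlgebra.subset_adjoin ℂ _ (Or.inr ⟨ξ, rfl⟩))

/-- Two elements of `C*(Σ)` agree when their components at all pairs agree. -/
theorem CStar.ext {a b : S.CStar} (h : ∀ i, (Subtype.val a : S.Ambient) i =
    (Subtype.val b : S.Ambient) i) : a = b :=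
  Subtype.ext (lp.ext (funext h))

/-- The universal pair. -/
def univPair : S.Pair S.CStar where
  t0 :=
    { toFun := fun f => ⟨S.ambientT0 f, S.ambientT0_mem f⟩
      map_smul' := fun c f => CStar.ext S fun i => map_smul i.ρ.t0 c f
      map_zero' := CStar.ext S fun i => map_zero i.ρ.t0
      map_add' := fun f g => CStar.ext S fun i => map_add i.ρ.t0 f g
      map_mul' := fun f g => CStar.ext S fun i => map_mul i.ρ.t0 f g
      map_star' := fun f => CStar.ext S fun i => map_star i.ρ.t0 f }
  t1 :=
    { toFun := fun ξ => ⟨S.ambientT1 ξ, S.ambientT1_mem ξ⟩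
      map_add' := fun ξ η => CStar.ext S fun i => map_add i.ρ.t1 ξ η
      map_smul' := fun c ξ => CStar.ext S fun i => map_smul i.ρ.t1 c ξ }
  star_t1_mul_t1 := fun ξ η => CStar.ext S fun i => i.ρ.star_t1_mul_t1 ξ η
  t1_mul_star_t1 := fun V hV hi ξ η hξ hη =>
    CStar.ext S fun i => i.ρ.t1_mul_star_t1 V hV hi ξ η hξ hη

variable {S} in
/-- The `*`-homomorphism `C*(Σ) → B` induced by a pair: the component at this pair. -/
def lift {B : Type u} [NonUnitalCStarAlgebra B] (ρ : S.Pair B) : S.CStar →⋆ₙₐ[ℂ] B where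
  toFun a := (Subtype.val a : S.Ambient) ⟨B, ρ⟩
  map_smul' _ _ := rfl
  map_zero' := rfl
  map_add' _ _ := rfl
  map_mul' _ _ := rfl
  map_star' _ := rfl

variable {S} in
theorem lift_t0 {B : Type u} [NonUnitalCStarAlgebra B] (ρ : S.Pair B) (f : C₀(X, ℂ)) :
    lift ρ (S.univPair.t0 f) = ρ.t0 f := rfl

variable {S} in
theorem lift_t1 {B : Type u} [NonUnitalCStarAlgebra B] (ρ : S.Pair B) (ξ : C_c(S.U, ℂ)) :
    lift ρ (S.univPair.t1 ξ) = ρ.t1 ξ := rfl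

/-- `C*(Σ)` is generated by the images of the universal pair: `*`-homomorphisms agreeing on them are
equal. -/
theorem hom_ext {B : Type w} [NonUnitalCStarAlgebra B] {φ ψ : S.CStar →⋆ₙₐ[ℂ] B}
    (h0 : ∀ f, φ (S.univPair.t0 f) = ψ (S.univPair.t0 f))
    (h1 : ∀ ξ, φ (S.univPair.t1 ξ) = ψ (S.univPair.t1 ξ)) : φ = ψ := by
  have hφ : Continuous φ := (NonUnitalStarAlgHom.instContinuousLinearMapClassComplex.map_continuous φ)
  have hψ : Continuous ψ := (NonUnitalStarAlgHom.instContinuousLinearMapClassComplex.map_continuous ψ)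
  have key : ∀ (a : S.Ambient) (ha : a ∈ NonUnitalStarAlgebra.adjoin ℂ
      (Set.range S.ambientT0 ∪ Set.range S.ambientT1)),
      φ ⟨a, NonUnitalStarSubalgebra.le_topologicalClosure _ ha⟩ =
        ψ ⟨a, NonUnitalStarSubalgebra.le_topologicalClosure _ ha⟩ := by
    intro a ha
    induction ha using NonUnitalStarAlgebra.adjoin_induction with
    | mem x hx =>
      rcases hx with ⟨f, rfl⟩ | ⟨ξ, rfl⟩
      · exact h0 f
      · exact h1 ξ
    | add x y hx hy ihx ihy =>
      exact (map_add φ _ _).trans ((congrArg₂ (· + ·) ihx ihy).trans (map_add ψ _ _).symm)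
    | zero => exact (map_zero φ).trans (map_zero ψ).symm
    | mul x y hx hy ihx ihy =>
      exact (map_mul φ _ _).trans ((congrArg₂ (· * ·) ihx ihy).trans (map_mul ψ _ _).symm)
    | smul c x hx ihx =>
      exact (map_smul φ _ _).trans ((congrArg (c • ·) ihx).trans (map_smul ψ _ _).symm)
    | star x hx ihx =>
      exact (map_star φ _).trans ((congrArg star ihx).trans (map_star ψ _).symm)
  refine DFunLike.ext _ _ fun a => ?_
  obtain ⟨a, ha⟩ := a
  obtain ⟨s, hs, hlim⟩ := mem_closure_iff_seq_limit.1 ha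
  have hlim' : Filter.Tendsto
      (fun n => (⟨s n, NonUnitalStarSubalgebra.le_topologicalClosure _ (hs n)⟩ : S.CStar))
      Filter.atTop (𝓝 ⟨a, ha⟩) := tendsto_subtype_rng.2 hlim
  refine tendsto_nhds_unique ((hφ.tendsto _).comp hlim') ?_
  refine ((hψ.tendsto _).comp hlim').congr fun n => ?_
  exact (key _ (hs n)).symm

/-- The universal property. -/
theorem existsUnique_lift {B : Type u} [NonUnitalCStarAlgebra B] (ρ : S.Pair B) :
    ∃! φ : S.CStar →⋆ₙₐ[ℂ] B,
      (∀ f, φ (S.univPair.t0 f) = ρ.t0 f) ∧ ∀ ξ, φ (S.univPair.t1 ξ) = ρ.t1 ξ :=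
  ⟨lift ρ, ⟨lift_t0 ρ, lift_t1 ρ⟩, fun _ hψ =>
    S.hom_ext (fun f => hψ.1 f) fun ξ => hψ.2 ξ⟩

end Universal

/-! ### The orbit representations -/

section Weighted

variable {O : Type u}

/-- The Hilbert space with orthonormal basis indexed by `O`. -/
abbrev Hilb (O : Type u) : Type u := lp (fun _ : O => ℂ) 2

/-- The weights `w` are square summable on the fibres of `φ`, with sums at most `C²`. -/
def FiberBound (w : O → ℂ) (φ : O → O) (C : ℝ) : Prop :=
  0 ≤ C ∧ ∀ (x : O) (s : Finset O), (∀ y ∈ s, φ y = x) → ∑ y ∈ s, ‖w y‖ ^ 2 ≤ C ^ 2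

theorem FiberBound.sum_le {w : O → ℂ} {φ : O → O} {C : ℝ} (h : FiberBound w φ C) (v : Hilb O)
    (s : Finset O) :
    ∑ y ∈ s, ‖w y * v (φ y)‖ ^ (2 : ℝ≥0∞).toReal ≤ (C * ‖v‖) ^ (2 : ℝ≥0∞).toReal := by
  classical
  have h2 := lp.sum_rpow_le_norm_rpow (p := 2) (by norm_num) v (s.image φ)
  simp only [ENNReal.toReal_ofNat, Real.rpow_two] at h2 ⊢
  rw [← Finset.sum_fiberwise_of_maps_to (t := s.image φ) (g := φ)
    (fun y hy => Finset.mem_image_of_mem φ hy), mul_pow]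
  calc _ ≤ ∑ x ∈ s.image φ, C ^ 2 * ‖v x‖ ^ 2 := by
        refine Finset.sum_le_sum fun x _ => ?_
        have h3 := h.2 x (s.filter fun y => φ y = x) (by simp)
        calc _ = (∑ y ∈ s with φ y = x, ‖w y‖ ^ 2) * ‖v x‖ ^ 2 := by
              rw [Finset.sum_mul]
              refine Finset.sum_congr rfl fun y hy => ?_
              rw [(Finset.mem_filter.1 hy).2, norm_mul, mul_pow]
          _ ≤ _ := by gcongr
    _ = C ^ 2 * ∑ x ∈ s.image φ, ‖v x‖ ^ 2 := by rw [Finset.mul_sum]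
    _ ≤ _ := by gcongr

/-- The weighted composition operator `(T v)(y) = w(y) v(φ(y))`. -/
def weighted (w : O → ℂ) (φ : O → O) (C : ℝ) (h : FiberBound w φ C) : Hilb O →L[ℂ] Hilb O :=
  LinearMap.mkContinuous
    { toFun := fun v => ⟨fun y => w y * v (φ y), memℓp_gen' (h.sum_le v)⟩
      map_add' := fun u v => lp.ext (funext fun y => mul_add _ _ _)
      map_smul' := fun c v => lp.ext (funext fun y => mul_left_comm _ _ _) }
    C fun v => lp.norm_le_of_forall_sum_le (by norm_num) (mul_nonneg h.1 (norm_nonneg _))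
      (h.sum_le v)

theorem weighted_apply (w : O → ℂ) (φ : O → O) (C : ℝ) (h : FiberBound w φ C) (v : Hilb O)
    (y : O) : weighted w φ C h v y = w y * v (φ y) := rfl

open Classical in
/-- The basis vector `δ_x`. -/
def delta (x : O) : Hilb O := lp.single 2 x 1

open Classical in
theorem delta_apply (x y : O) : delta x y = if y = x then 1 else 0 := by
  rw [delta, lp.single_apply, Pi.single_apply]

theorem inner_delta_left (x : O) (v : Hilb O) : inner ℂ (delta x) v = v x := by
  classical
  rw [delta, lp.inner_single_left]
  simp

theorem ext_delta {S T : Hilb O →L[ℂ] Hilb O} (h : ∀ x, S (delta x) = T (delta x)) : S = T := by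
  classical
  refine lp.ext_continuousLinearMap (by norm_num) fun x => ?_
  ext1
  exact h x

/-- The adjoint of a weighted composition operator maps `δ_y` to `conj(w(y)) δ_{φ(y)}`. -/
theorem star_weighted_delta (w : O → ℂ) (φ : O → O) (C : ℝ) (h : FiberBound w φ C) (y : O) :
    (star (weighted w φ C h)) (delta y) = star (w y) • delta (φ y) := by
  refine lp.ext (funext fun x => ?_)
  rw [← inner_delta_left, ContinuousLinearMap.star_eq_adjoint,
    ContinuousLinearMap.adjoint_inner_right, ← inner_conj_symm, inner_delta_left, weighted_apply,
    lp.coeFn_smul, Pi.smul_apply, delta_apply, delta_apply, smul_eq_mul, map_mul]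
  by_cases hx : φ y = x
  · simp [hx]
  · simp [hx, Ne.symm hx]

end Weighted

section Representations

variable [T2Space X] [LocallyCompactSpace X] (S : SGDS X)

/-- The Hilbert space `H_{x₀}` with orthonormal basis `(δ_x)`, `x` in the orbit of `x₀`. -/
abbrev H (x₀ : X) : Type u := Hilb (S.Orb x₀)

open Classical in
/-- The map `σ` on the orbit of `x₀`, extended by the identity outside of the domain of `σ`. -/
def orbMap (x₀ : X) (y : S.Orb x₀) : S.Orb x₀ :=
  if h : (y : X) ∈ S.U then ⟨S.σ ⟨y, h⟩, (S.map_mem_orb_iff ⟨y, h⟩).2 y.2⟩ else y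

theorem orbMap_of_mem (x₀ : X) (y : S.Orb x₀) (h : (y : X) ∈ S.U) :
    (S.orbMap x₀ y : X) = S.σ ⟨y, h⟩ := by
  rw [orbMap, dif_pos h]

theorem t0_bound (x₀ : X) (f : C₀(X, ℂ)) :
    FiberBound (fun y : S.Orb x₀ => f y) id ‖f‖ := by
  refine ⟨norm_nonneg _, fun x s hs => ?_⟩
  have h1 : s ⊆ {x} := fun y hy => Finset.mem_singleton.2 (hs y hy)
  calc _ ≤ ∑ y ∈ {x}, ‖f (y : S.Orb x₀)‖ ^ 2 :=
        Finset.sum_le_sum_of_subset_of_nonneg h1 fun _ _ _ => by positivity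
    _ ≤ _ := by
        rw [Finset.sum_singleton]
        gcongr
        exact f.toBCF.norm_coe_le_norm x

/-- The operator `t⁰_{(x₀,γ₀)}(f)`, which maps `δ_x` to `f(x) δ_x`. -/
def orbT0 (x₀ : X) (f : C₀(X, ℂ)) : S.H x₀ →L[ℂ] S.H x₀ :=
  weighted (fun y => f y) id ‖f‖ (S.t0_bound x₀ f)

/-- The sum defining `⟨ξ, η⟩(x)` as a sum over the orbit. -/
theorem ip_eq_sum (x₀ : X) (ξ η : C_c(S.U, ℂ)) (x : S.Orb x₀) (s : Finset (S.Orb x₀))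
    (hs : ∀ y ∈ s, ∃ h : (y : X) ∈ S.U, S.σ ⟨y, h⟩ = x)
    (hs' : ∀ (y : S.Orb x₀) (h : (y : X) ∈ S.U), S.σ ⟨y, h⟩ = x →
      star (ξ ⟨y, h⟩) * η ⟨y, h⟩ ≠ 0 → y ∈ s) :
    S.ip ξ η x = ∑ y ∈ s, star (S.extendZero ξ y) * S.extendZero η y := by
  classical
  rw [ip_apply]
  have hfin : {y : S.U | ∃ h : (y : X) ∈ S.Orb x₀, (⟨y, h⟩ : S.Orb x₀) ∈ s}.Finite := by
    refine Set.Finite.subset ((s.finite_toSet.image Subtype.val).preimage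
      Subtype.val_injective.injOn) ?_
    rintro y ⟨h, hy⟩
    exact ⟨⟨y, h⟩, hy, rfl⟩
  let t : Finset S.U := hfin.toFinset
  have hmem : ∀ y : S.U, y ∈ t ↔ ∃ h : (y : X) ∈ S.Orb x₀, (⟨y, h⟩ : S.Orb x₀) ∈ s :=
    fun y => hfin.mem_toFinset
  rw [finsum_eq_sum_of_support_subset (s := t)]
  · refine Finset.sum_bij' (fun y hy => ⟨y, ((hmem y).1 hy).1⟩)
      (fun y hy => ⟨y, (hs y hy).1⟩) (fun y hy => ((hmem y).1 hy).2)
      (fun y hy => (hmem _).2 ⟨y.2, hy⟩) (fun _ _ => rfl) (fun _ _ => rfl) fun y hy => ?_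
    obtain ⟨h1, h2⟩ := hs _ ((hmem y).1 hy).2
    rw [finsum_eq_if, if_pos h2, extendZero_coe, extendZero_coe]
  · intro y hy
    rw [Function.mem_support, finsum_eq_if] at hy
    split_ifs at hy with h1
    · have hyO : (y : X) ∈ S.Orb x₀ := (S.map_mem_orb_iff y).1 (h1 ▸ x.2)
      exact Finset.mem_coe.2 ((hmem y).2 ⟨hyO, hs' ⟨y, hyO⟩ y.2 h1 hy⟩)
    · exact absurd rfl hy

/-- A finite set containing all points `y` of the fibre `σ(y) = x` with `ξ(y) ≠ 0`. -/
theorem exists_fiber (x₀ : X) (ξ : C_c(S.U, ℂ)) (x : S.Orb x₀) :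
    ∃ s : Finset (S.Orb x₀), (∀ y ∈ s, ∃ h : (y : X) ∈ S.U, S.σ ⟨y, h⟩ = x) ∧
      ∀ (y : S.Orb x₀) (h : (y : X) ∈ S.U), S.σ ⟨y, h⟩ = x → ξ ⟨y, h⟩ ≠ 0 → y ∈ s := by
  have h1 := fiberSum_finite S.isLocalHomeomorph ξ.hasCompactSupport (x : X)
  have h2 := (h1.image Subtype.val).preimage
    (Subtype.val_injective (p := fun y => y ∈ S.Orb x₀)).injOn
  refine ⟨h2.toFinset, fun y hy => ?_, fun y h hy hξ => ?_⟩
  · rw [Set.Finite.mem_toFinset] at hy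
    obtain ⟨a, ⟨ha, _⟩, hay⟩ := hy
    exact ⟨hay ▸ a.2, by rw [← ha]; congr 1; exact Subtype.ext hay.symm⟩
  · rw [Set.Finite.mem_toFinset]
    exact ⟨⟨y, h⟩, ⟨hy, hξ⟩, rfl⟩

theorem t1_bound (x₀ : X) (γ : Circle) (ξ : C_c(S.U, ℂ)) :
    FiberBound (fun y : S.Orb x₀ => (γ : ℂ) * S.extendZero ξ y) (S.orbMap x₀)
      (Real.sqrt ‖S.ip ξ ξ‖) := by
  refine ⟨Real.sqrt_nonneg _, fun x s hs => ?_⟩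
  obtain ⟨F, hF, hF'⟩ := S.exists_fiber x₀ ξ x
  have hip := S.ip_eq_sum x₀ ξ ξ x F hF
    (fun y h hy hne => hF' y h hy (right_ne_zero_of_mul hne))
  have hre : S.ip ξ ξ x = ((∑ y ∈ F, ‖S.extendZero ξ y‖ ^ 2 : ℝ) : ℂ) := by
    rw [hip, Complex.ofReal_sum]
    refine Finset.sum_congr rfl fun y _ => ?_
    rw [Complex.ofReal_pow]
    exact Complex.conj_mul' _
  rw [Real.sq_sqrt (norm_nonneg _)]
  classical
  calc _ = ∑ y ∈ s, ‖S.extendZero ξ y‖ ^ 2 :=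
        Finset.sum_congr rfl fun y _ => by rw [norm_mul, Circle.norm_coe, one_mul]
    _ = ∑ y ∈ s.filter (fun y : S.Orb x₀ => S.extendZero ξ y ≠ 0), ‖S.extendZero ξ y‖ ^ 2 := by
        refine (Finset.sum_filter_of_ne (p := fun y : S.Orb x₀ => S.extendZero ξ y ≠ 0)
          fun y _ hy h0 => hy ?_).symm
        rw [h0]
        simp
    _ ≤ ∑ y ∈ F, ‖S.extendZero ξ y‖ ^ 2 := by
        refine Finset.sum_le_sum_of_subset_of_nonneg (fun y hy => ?_) fun _ _ _ => by positivity
        obtain ⟨hys, hy0⟩ := Finset.mem_filter.1 hy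
        by_cases h : (y : X) ∈ S.U
        · refine hF' y h ?_ ?_
          · rw [← S.orbMap_of_mem x₀ y h, hs y hys]
          · rwa [← S.extendZero_coe ξ ⟨y, h⟩]
        · exact absurd (S.extendZero_of_notMem ξ h) hy0
    _ = ‖S.ip ξ ξ x‖ := by
        rw [hre, Complex.norm_real, Real.norm_of_nonneg]
        exact Finset.sum_nonneg fun _ _ => by positivity
    _ ≤ _ := (S.ip ξ ξ).toBCF.norm_coe_le_norm x

/-- The operator `t¹_{(x₀,γ)}(ξ)`, which maps `δ_x` to `γ ∑_{σ(y) = x} ξ(y) δ_y`; see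
`orbT1_delta`. -/
def orbT1 (x₀ : X) (γ : Circle) (ξ : C_c(S.U, ℂ)) : S.H x₀ →L[ℂ] S.H x₀ :=
  weighted (fun y => (γ : ℂ) * S.extendZero ξ y) (S.orbMap x₀) (Real.sqrt ‖S.ip ξ ξ‖)
    (S.t1_bound x₀ γ ξ)

theorem orbT0_delta (x₀ : X) (f : C₀(X, ℂ)) (x : S.Orb x₀) :
    S.orbT0 x₀ f (delta x) = f x • delta x := by
  refine lp.ext (funext fun y => ?_)
  rw [orbT0, weighted_apply, lp.coeFn_smul, Pi.smul_apply, smul_eq_mul, id,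
    delta_apply]
  split_ifs with h
  · rw [h]
  · rw [mul_zero, mul_zero]

theorem orbT1_delta (x₀ : X) (γ : Circle) (ξ : C_c(S.U, ℂ)) (x : S.Orb x₀)
    (s : Finset (S.Orb x₀)) (hs : ∀ y ∈ s, ∃ h : (y : X) ∈ S.U, S.σ ⟨y, h⟩ = x)
    (hs' : ∀ (y : S.Orb x₀) (h : (y : X) ∈ S.U), S.σ ⟨y, h⟩ = x → ξ ⟨y, h⟩ ≠ 0 → y ∈ s) :
    S.orbT1 x₀ γ ξ (delta x) = (γ : ℂ) • ∑ y ∈ s, S.extendZero ξ y • delta y := by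
  classical
  refine lp.ext (funext fun z => ?_)
  rw [orbT1, weighted_apply, lp.coeFn_smul, Pi.smul_apply, lp.coeFn_sum, Finset.sum_apply,
    smul_eq_mul, mul_assoc, delta_apply]
  congr 1
  simp only [lp.coeFn_smul, Pi.smul_apply, delta_apply, smul_eq_mul, mul_ite, mul_one, mul_zero]
  rw [Finset.sum_ite_eq]
  by_cases h : (z : X) ∈ S.U
  · by_cases hz : z ∈ s
    · obtain ⟨h1, h2⟩ := hs z hz
      rw [if_pos hz, if_pos (Subtype.ext ((S.orbMap_of_mem x₀ z h).trans h2))]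
    · rw [if_neg hz]
      split_ifs with hx
      · by_contra hne
        refine hz (hs' z h ?_ ?_)
        · rw [← S.orbMap_of_mem x₀ z h, hx]
        · rwa [← S.extendZero_coe ξ ⟨z, h⟩]
      · rfl
  · rw [S.extendZero_of_notMem ξ h]
    simp

theorem star_orbT1_delta (x₀ : X) (γ : Circle) (ξ : C_c(S.U, ℂ)) (y : S.Orb x₀) :
    star (S.orbT1 x₀ γ ξ) (delta y) =
      star ((γ : ℂ) * S.extendZero ξ y) • delta (S.orbMap x₀ y) :=
  star_weighted_delta _ _ _ _ y

theorem star_circle_mul (γ : Circle) : star (γ : ℂ) * γ = 1 := by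
  rw [Complex.star_def, ← Circle.coe_inv_eq_conj, ← Circle.coe_mul, inv_mul_cancel, Circle.coe_one]

/-- The pair `(t⁰_{(x₀,γ)}, t¹_{(x₀,γ)})` with values in `B(H_{x₀})`. -/
def orbPair (x₀ : X) (γ : Circle) : S.Pair (S.H x₀ →L[ℂ] S.H x₀) where
  t0 :=
    { toFun := S.orbT0 x₀
      map_smul' := fun c f => ext_delta fun x => by
        change _ = c • S.orbT0 x₀ f (delta x)
        rw [orbT0_delta, orbT0_delta, smul_smul]
        rfl
      map_zero' := ext_delta fun x => by
        rw [orbT0_delta]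
        exact zero_smul ℂ _
      map_add' := fun f g => ext_delta fun x => by
        change _ = S.orbT0 x₀ f (delta x) + S.orbT0 x₀ g (delta x)
        rw [orbT0_delta, orbT0_delta, orbT0_delta, ← add_smul]
        rfl
      map_mul' := fun f g => ext_delta fun x => by
        change _ = S.orbT0 x₀ f (S.orbT0 x₀ g (delta x))
        rw [orbT0_delta, orbT0_delta, map_smul, orbT0_delta, smul_smul, mul_comm]
        rfl
      map_star' := fun f => ext_delta fun x => by
        refine Eq.trans ?_ (star_weighted_delta _ _ _ _ x).symm
        exact S.orbT0_delta x₀ (star f) x }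
  t1 :=
    { toFun := S.orbT1 x₀ γ
      map_add' := fun ξ η => by
        refine ContinuousLinearMap.ext fun v => lp.ext (funext fun y => ?_)
        change (γ : ℂ) * S.extendZero (ξ + η) y * v _ =
          (γ : ℂ) * S.extendZero ξ y * v _ + (γ : ℂ) * S.extendZero η y * v _
        by_cases h : (y : X) ∈ S.U
        · have h1 := S.extendZero_coe (ξ + η) ⟨y, h⟩
          have h2 := S.extendZero_coe ξ ⟨y, h⟩
          have h3 := S.extendZero_coe η ⟨y, h⟩
          simp only at h1 h2 h3
          rw [h1, h2, h3, CompactlySupportedContinuousMap.add_apply]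
          ring
        · rw [S.extendZero_of_notMem _ h, S.extendZero_of_notMem _ h, S.extendZero_of_notMem _ h]
          ring
      map_smul' := fun c ξ => by
        refine ContinuousLinearMap.ext fun v => lp.ext (funext fun y => ?_)
        change (γ : ℂ) * S.extendZero (c • ξ) y * v _ = c * ((γ : ℂ) * S.extendZero ξ y * v _)
        by_cases h : (y : X) ∈ S.U
        · have h1 := S.extendZero_coe (c • ξ) ⟨y, h⟩
          have h2 := S.extendZero_coe ξ ⟨y, h⟩
          simp only at h1 h2
          rw [h1, h2, CompactlySupportedContinuousMap.smul_apply, smul_eq_mul]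
          ring
        · rw [S.extendZero_of_notMem _ h, S.extendZero_of_notMem _ h]
          ring }
  star_t1_mul_t1 := fun ξ η => ext_delta fun x => by
    obtain ⟨F, hF, hF'⟩ := S.exists_fiber x₀ η x
    change star (S.orbT1 x₀ γ ξ) (S.orbT1 x₀ γ η (delta x)) = S.orbT0 x₀ (S.ip ξ η) (delta x)
    rw [orbT0_delta, S.orbT1_delta x₀ γ η x F hF hF', S.ip_eq_sum x₀ ξ η x F hF
      (fun y h hy hne => hF' y h hy (right_ne_zero_of_mul hne)), map_smul, map_sum,
      Finset.sum_smul, Finset.smul_sum]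
    refine Finset.sum_congr rfl fun y hy => ?_
    obtain ⟨h, hσ⟩ := hF y hy
    have hx : S.orbMap x₀ y = x := Subtype.ext ((S.orbMap_of_mem x₀ y h).trans hσ)
    rw [map_smul, star_orbT1_delta, hx, smul_smul, smul_smul, star_mul]
    congr 1
    linear_combination (S.extendZero η y * star (S.extendZero ξ y)) * star_circle_mul γ
  t1_mul_star_t1 := fun V _ hi ξ η hξ hη => ext_delta fun y => by
    change S.orbT1 x₀ γ ξ (star (S.orbT1 x₀ γ η) (delta y)) =
      S.orbT0 x₀ (S.extendZero (ξ * star η)) (delta y)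
    rw [orbT0_delta, star_orbT1_delta, map_smul]
    by_cases h : (y : X) ∈ S.U
    · have e1 := S.extendZero_coe (ξ * star η) ⟨y, h⟩
      have e2 := S.extendZero_coe η ⟨y, h⟩
      have e3 := S.extendZero_coe ξ ⟨y, h⟩
      simp only at e1 e2 e3
      rw [e1, e2, CompactlySupportedContinuousMap.mul_apply,
        CompactlySupportedContinuousMap.star_apply]
      by_cases hη0 : η ⟨y, h⟩ = 0
      · rw [hη0]
        simp
      · have hyV : (⟨y, h⟩ : S.U) ∈ V := hη (subset_tsupport _ hη0)
        have hσy := S.orbMap_of_mem x₀ y h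
        rw [S.orbT1_delta x₀ γ ξ (S.orbMap x₀ y) {y}
          (fun z hz => by
            rw [Finset.mem_singleton] at hz
            subst hz
            exact ⟨h, hσy.symm⟩)
          (fun z hz hz' hne => by
            have hzV : (⟨z, hz⟩ : S.U) ∈ V := hξ (subset_tsupport _ hne)
            have := congrArg Subtype.val (hi hzV hyV (hz'.trans hσy))
            exact Finset.mem_singleton.2 (Subtype.ext this)),
          Finset.sum_singleton, e3, smul_smul, smul_smul, star_mul]
        congr 1
        linear_combination (ξ ⟨y, h⟩ * star (η ⟨y, h⟩)) * star_circle_mul γ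
    · rw [S.extendZero_of_notMem _ h, S.extendZero_of_notMem _ h]
      simp

/-- The representation `π_{(x₀,γ)}` of `C*(Σ)` on `H_{x₀}`. -/
def orbRep (x₀ : X) (γ : Circle) : S.CStar →⋆ₙₐ[ℂ] (S.H x₀ →L[ℂ] S.H x₀) :=
  lift (S.orbPair x₀ γ)

/-- The ideal `P_{(x₀,γ)}`, the kernel of `π_{(x₀,γ)}`. -/
def P (x₀ : X) (γ : Circle) : TwoSidedIdeal S.CStar := TwoSidedIdeal.ker (S.orbRep x₀ γ)

/-- The set `Y_I` of all `(x, γ)` with `I ⊆ P_{(x,γ)}`. -/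
def idealSet (I : TwoSidedIdeal S.CStar) : Set (X × Circle) := {z | I ≤ S.P z.1 z.2}

end Representations

/-! ### Admissible sets -/

section Admissible

/-- The slice `Y_x = {γ | (x, γ) ∈ Y}`. -/
def slice (Y : Set (X × Circle)) (x : X) : Set Circle := {γ | (x, γ) ∈ Y}

/-- The root of unity `ζ_n = e^{2πi/n}`. -/
def zeta (n : ℕ) : Circle := Circle.exp (2 * Real.pi / n)

/-- Admissible subsets of `X × 𝕋`. -/
structure IsAdmissible (S : SGDS X) (Y : Set (X × Circle)) : Prop where
  isClosed : IsClosed Y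
  slice_map : ∀ x : S.U, slice Y x = slice Y (S.σ x)
  slice_proper : ∀ x₀ : X, slice Y x₀ ≠ ∅ → slice Y x₀ ≠ Set.univ →
    S.IsPeriodic x₀ ∧ zeta (S.minPeriod x₀) • slice Y x₀ = slice Y x₀ ∧
      ∃ V ∈ 𝓝 x₀, ∀ x ∈ V, S.preperiod x ≠ S.preperiod x₀ → slice Y x = ∅

end Admissible

end SGDS

end

/-! Everything is read off the vector states `vecState x γ`, that is, a ↦ ⟨δ_x, π_{(x,γ)}(a) δ_x⟩.
The span of the elements satisfying `IsWord` is dense in C*(Σ), and on such an element the state is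
explicit: g(x) γ^(k-l) if σᵏ(x) = σˡ(x), and 0 otherwise, with g continuous and vanishing off the
domains of σᵏ and σˡ. The states are 1-Lipschitz in a, so statements that are closed in a need only
be checked on words (`word_induction`).

Basis vectors of one orbit are carried to each other, up to a scalar, by t¹(ξ) and t¹(ξ)* for bump
functions ξ. Hence (x,γ) ∈ Y_I exactly when the state at (x,γ) vanishes on I (`mem_idealSet_iff`),
and Y_I is constant along orbits. Since γ enters only through γ^(k-l) with k-l in the isotropy of x,
the state is unchanged when γ is multiplied by a number trivial on the isotropy. For aperiodic x the
slice is therefore empty or all of 𝕋, and for periodic x it is invariant under the p(x)-th roots of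
unity.

The topological conditions come from limits. Let an ultrafilter on Y_I converge to (x,γ), and let H
≤ ℤ consist of the k-l for which σᵏ = σˡ holds along it, both iterates being defined at x
(`limitIsotropy`). On a word the states tend to g(x) γ^(k-l) if σᵏ(x) = σˡ(x) and k-l ∈ H, and to 0
otherwise. This is the Haar mean over z ∈ H^⊥ of the states at (x,γz) (`tendsto_vecState`). For a ∈
I the limit on a*a is 0, while the integrand ‖π_{(x,γz)}(a)δ_x‖² is continuous and nonnegative; so
it vanishes for every z ∈ H^⊥, and (x,γz) ∈ Y_I (`mem_idealSet_of_ultrafilter`). Taking z = 1 gives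
closedness. If points with nonempty slice and preperiod different from l(x₀) accumulate at a
periodic x₀, then H = 0 (`limitIsotropy_eq_bot`), so H^⊥ = 𝕋 and the slice at x₀ is everything. -/

noncomputable section

namespace SGDS

variable {X : Type u} [TopologicalSpace X]

/-! ### Iterates of the partial map, written with a total map and explicit domains. -/

section TotalMap

variable (S : SGDS X)

open Classical in
/-- The map `σ`, extended by the identity outside of its domain. -/
def tot (x : X) : X := if h : x ∈ S.U then S.σ ⟨x, h⟩ else x

/-- The domain of the iterate `σⁿ`. -/
def dom (n : ℕ) : Set X := {x | ∀ j < n, S.tot^[j] x ∈ S.U}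

theorem tot_of_mem {x : X} (h : x ∈ S.U) : S.tot x = S.σ ⟨x, h⟩ := by
  rw [tot, dif_pos h]

theorem dom_zero : S.dom 0 = Set.univ := by
  simp [dom]

theorem mem_dom_succ {n : ℕ} {x : X} : x ∈ S.dom (n + 1) ↔ x ∈ S.dom n ∧ S.tot^[n] x ∈ S.U :=
  Nat.forall_lt_succ_right

theorem mem_dom_add {m n : ℕ} {x : X} :
    x ∈ S.dom (m + n) ↔ x ∈ S.dom m ∧ S.tot^[m] x ∈ S.dom n := by
  induction n with
  | zero => simp [dom_zero]
  | succ n ih =>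
    rw [← add_assoc, mem_dom_succ, ih, mem_dom_succ, add_comm m n, Function.iterate_add_apply,
      and_assoc]

theorem mem_dom_succ' {n : ℕ} {x : X} : x ∈ S.dom (n + 1) ↔ x ∈ S.U ∧ S.tot x ∈ S.dom n := by
  rw [add_comm, mem_dom_add]
  simp [dom]

theorem dom_anti {m n : ℕ} (h : m ≤ n) : S.dom n ⊆ S.dom m :=
  fun _ hx j hj => hx j (hj.trans_le h)

theorem iter_eq_some_iff {n : ℕ} {x y : X} :
    S.iter n x = some y ↔ x ∈ S.dom n ∧ S.tot^[n] x = y := by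
  induction n generalizing y with
  | zero => simp [iter, dom_zero]
  | succ n ih =>
    rw [iter, Option.bind_eq_some_iff, mem_dom_succ]
    simp only [ih, step, Function.iterate_succ_apply']
    constructor
    · rintro ⟨z, ⟨hz, rfl⟩, h⟩
      split_ifs at h with hU
      exact ⟨⟨hz, hU⟩, by rw [S.tot_of_mem hU]; exact Option.some.inj h⟩
    · rintro ⟨⟨hz, hU⟩, rfl⟩
      exact ⟨_, ⟨hz, rfl⟩, by rw [dif_pos hU, S.tot_of_mem hU]⟩

/-- The domain conditions cannot be dropped: `tot` fixes every point outside U, so its iterates can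
coincide where those of σ are undefined. The support conditions on F and G in `IsWord` give such
spurious coincidences weight zero. -/
theorem iterEq_iff {a b : ℕ} {x y : X} :
    S.IterEq a x b y ↔ x ∈ S.dom a ∧ y ∈ S.dom b ∧ S.tot^[a] x = S.tot^[b] y := by
  simp only [IterEq, iter_eq_some_iff]
  constructor
  · rintro ⟨z, ⟨h1, h2⟩, h3, h4⟩
    exact ⟨h1, h3, h2.trans h4.symm⟩
  · rintro ⟨h1, h2, h3⟩
    exact ⟨_, ⟨h1, h3⟩, h2, rfl⟩

theorem continuousAt_tot {x : X} (h : x ∈ S.U) : ContinuousAt S.tot x := by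
  have : S.tot ∘ Subtype.val = S.σ := funext fun y => S.tot_of_mem y.2
  refine (S.U.isOpen.isOpenEmbedding_subtypeVal.continuousAt_iff (x := ⟨x, h⟩)).1 ?_
  refine this ▸ ?_
  exact S.isLocalHomeomorph.continuous.continuousAt

theorem exists_injOn_tot {x : X} (h : x ∈ S.U) : ∃ V ∈ 𝓝 x, Set.InjOn S.tot V := by
  obtain ⟨W, hWo, hxW, hW⟩ := S.isLocalHomeomorph.isLocallyInjective ⟨x, h⟩
  refine ⟨Subtype.val '' W, (S.U.isOpen.isOpenMap_subtype_val W hWo).mem_nhds ⟨_, hxW, rfl⟩, ?_⟩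
  rintro _ ⟨a, ha, rfl⟩ _ ⟨b, hb, rfl⟩ hab
  rw [S.tot_of_mem a.2, S.tot_of_mem b.2] at hab
  rw [hW ha hb hab]

theorem continuousAt_iterate_tot {n : ℕ} {x : X} (h : x ∈ S.dom n) :
    ContinuousAt S.tot^[n] x := by
  induction n with
  | zero => exact continuousAt_id
  | succ n ih =>
    rw [mem_dom_succ] at h
    rw [Function.iterate_succ']
    exact (S.continuousAt_tot h.2).comp (ih h.1)

theorem isOpen_dom (n : ℕ) : IsOpen (S.dom n) := by
  induction n with
  | zero => rw [dom_zero]; exact isOpen_univ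
  | succ n ih =>
    rw [isOpen_iff_mem_nhds]
    intro x hx
    rw [mem_dom_succ] at hx
    filter_upwards [ih.mem_nhds hx.1,
      (S.continuousAt_iterate_tot hx.1).eventually (S.U.isOpen.mem_nhds hx.2)] with y h1 h2
    exact (S.mem_dom_succ).2 ⟨h1, h2⟩

/-- The iterates of `σ` are locally injective. -/
theorem eventually_eq_of_iterate_eq {ι : Type*} {l : Filter ι} {a b : ι → X} {x : X} {n : ℕ}
    (hx : x ∈ S.dom n) (ha : Filter.Tendsto a l (𝓝 x)) (hb : Filter.Tendsto b l (𝓝 x))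
    (h : ∀ᶠ i in l, S.tot^[n] (a i) = S.tot^[n] (b i)) : ∀ᶠ i in l, a i = b i := by
  induction n with
  | zero => exact h
  | succ n ih =>
    rw [mem_dom_succ] at hx
    refine ih hx.1 ?_
    obtain ⟨V, hV, hinj⟩ := S.exists_injOn_tot hx.2
    have hc := (S.continuousAt_iterate_tot hx.1).tendsto
    filter_upwards [h, (hc.comp ha) hV, (hc.comp hb) hV] with i h1 h2 h3
    simp only [Function.iterate_succ_apply'] at h1
    exact hinj h2 h3 h1

/-- A coincidence σᵏ(x) = σˡ(x) with l < k puts x on a path that enters a cycle, so the iteration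
never leaves U: j + 1 further steps from σˡ(x) are the same as j + 1 further steps from σᵏ(x). -/
theorem mem_dom_of_iterate_eq {k l : ℕ} {x : X} (hk : x ∈ S.dom k) (hl : x ∈ S.dom l)
    (h : S.tot^[k] x = S.tot^[l] x) (hne : k ≠ l) (n : ℕ) : x ∈ S.dom n := by
  wlog hlt : l < k generalizing k l
  · exact this hl hk h.symm hne.symm (by omega)
  induction n using Nat.strong_induction_on with
  | _ n ih =>
    by_cases hn : n ≤ k
    · exact S.dom_anti hn hk
    · obtain ⟨j, rfl⟩ := Nat.exists_eq_add_of_lt (not_le.1 hn)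
      have h1 : x ∈ S.dom (l + (j + 1)) := ih _ (by omega)
      rw [mem_dom_add, ← h] at h1
      exact (S.mem_dom_add (m := k) (n := j + 1)).2 ⟨hk, h1.2⟩

end TotalMap

/-! ### Periods and preperiods. -/

section Periods

variable (S : SGDS X)

theorem iterate_eq_of_le {j k n : ℕ} {x : X} (hjk : j ≤ k)
    (h : S.tot^[j + n] x = S.tot^[j] x) : S.tot^[k + n] x = S.tot^[k] x := by
  obtain ⟨i, rfl⟩ := Nat.exists_eq_add_of_le hjk
  rw [show j + i + n = i + (j + n) by omega, Function.iterate_add_apply, h,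
    ← Function.iterate_add_apply, add_comm i]

theorem isPeriodicPt_iterate_iff {k n : ℕ} {x : X} :
    Function.IsPeriodicPt S.tot n (S.tot^[k] x) ↔ S.tot^[k + n] x = S.tot^[k] x := by
  rw [Function.IsPeriodicPt, Function.IsFixedPt, ← Function.iterate_add_apply, add_comm n]

theorem IterEq.mem_dom {S : SGDS X} {k n : ℕ} {x : X} (h : S.IterEq (k + n) x k x) (hn : 1 ≤ n)
    (m : ℕ) : x ∈ S.dom m := by
  obtain ⟨h1, h2, h3⟩ := S.iterEq_iff.1 h
  exact S.mem_dom_of_iterate_eq h1 h2 h3 (by omega) m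

/-- The period of `x` is the minimal period of an iterate of `x` which is periodic under the
extended map. -/
theorem minPeriod_eq {k n : ℕ} {x : X} (hn : 1 ≤ n) (h : S.IterEq (k + n) x k x) :
    S.minPeriod x = Function.minimalPeriod S.tot (S.tot^[k] x) := by
  have hd := h.mem_dom hn
  have hper := S.isPeriodicPt_iterate_iff.2 (S.iterEq_iff.1 h).2.2
  have hmem : Function.minimalPeriod S.tot (S.tot^[k] x) ∈
      {n | 1 ≤ n ∧ ∃ k, S.IterEq (k + n) x k x} :=
    ⟨hper.minimalPeriod_pos hn, k, S.iterEq_iff.2 ⟨hd _, hd _,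
      S.isPeriodicPt_iterate_iff.1 (Function.isPeriodicPt_minimalPeriod _ _)⟩⟩
  refine le_antisymm (Nat.sInf_le hmem) ?_
  obtain ⟨h1, j, h2⟩ := Nat.sInf_mem ⟨_, hmem⟩
  have h3 := (S.iterEq_iff.1 h2).2.2
  refine Nat.le_of_dvd h1 ?_
  -- The minimal period is constant along a cycle, so the starting indices k and j can both be
  -- replaced by j + k.
  have h4 : Function.minimalPeriod S.tot (S.tot^[k] x) =
      Function.minimalPeriod S.tot (S.tot^[j + k] x) := by
    rw [Function.iterate_add_apply]
    exact (Function.minimalPeriod_apply_iterate (Function.mk_mem_periodicPts hn hper) j).symm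
  rw [h4]
  exact (S.isPeriodicPt_iterate_iff.2 (S.iterate_eq_of_le (by omega) h3)).minimalPeriod_dvd

theorem minPeriod_dvd {k n : ℕ} {x : X} (h : S.IterEq (k + n) x k x) : S.minPeriod x ∣ n := by
  rcases Nat.eq_zero_or_pos n with rfl | hn
  · exact dvd_zero _
  · rw [S.minPeriod_eq hn h]
    exact (S.isPeriodicPt_iterate_iff.2 (S.iterEq_iff.1 h).2.2).minimalPeriod_dvd

theorem minPeriod_pos {x : X} (h : S.IsPeriodic x) : 1 ≤ S.minPeriod x := by
  obtain ⟨k, n, hn, h⟩ := h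
  exact (Nat.sInf_mem (s := {n | 1 ≤ n ∧ ∃ k, S.IterEq (k + n) x k x}) ⟨n, hn, k, h⟩).1

theorem IsPeriodic.mem_dom {S : SGDS X} {x : X} (h : S.IsPeriodic x) (m : ℕ) : x ∈ S.dom m := by
  obtain ⟨k, n, hn, h⟩ := h
  exact h.mem_dom hn m

/-- The preperiod can be tested with any positive multiple n of the period. This allows a comparison
of preperiods of points whose periods may differ, through a common multiple. -/
theorem minPreperiod_le_iff {j n : ℕ} {x : X} (hx : S.IsPeriodic x) (hn : 1 ≤ n)
    (hdvd : S.minPeriod x ∣ n) :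
    S.minPreperiod x ≤ j ↔ S.tot^[j + n] x = S.tot^[j] x := by
  have hd := hx.mem_dom
  constructor
  · intro hj
    refine S.iterate_eq_of_le hj ?_
    have hne : {k | S.IterEq (k + S.minPeriod x) x k x}.Nonempty := by
      obtain ⟨-, k, h⟩ := Nat.sInf_mem (s := {n | 1 ≤ n ∧ ∃ k, S.IterEq (k + n) x k x})
        (by obtain ⟨k, n, hn, h⟩ := hx; exact ⟨n, hn, k, h⟩)
      exact ⟨k, h⟩
    have h1 := (S.iterEq_iff.1 (Nat.sInf_mem hne)).2.2
    rw [← isPeriodicPt_iterate_iff] at h1 ⊢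
    exact h1.trans_dvd hdvd
  · intro h
    refine Nat.sInf_le (S.iterEq_iff.2 ⟨hd _, hd _, ?_⟩)
    rw [S.minPeriod_eq hn (S.iterEq_iff.2 ⟨hd _, hd _, h⟩), ← isPeriodicPt_iterate_iff]
    exact Function.isPeriodicPt_minimalPeriod _ _

theorem isPeriodic_of_iterEq {a b : ℕ} {x : X} (h : S.IterEq a x b x) (hne : a ≠ b) :
    S.IsPeriodic x := by
  rcases lt_or_gt_of_ne hne with hlt | hlt
  · obtain ⟨n, rfl⟩ := Nat.exists_eq_add_of_le hlt.le
    obtain ⟨z, h1, h2⟩ := h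
    exact ⟨a, n, by omega, z, h2, h1⟩
  · obtain ⟨n, rfl⟩ := Nat.exists_eq_add_of_le hlt.le
    exact ⟨b, n, by omega, h⟩

theorem zeta_pow {n : ℕ} (hn : 1 ≤ n) : zeta n ^ n = 1 := by
  have h0 : (n : ℝ) ≠ 0 := by positivity
  rw [zeta, ← Circle.exp_nsmul, nsmul_eq_mul, mul_div_cancel₀ _ h0, Circle.exp_two_pi]

/-- The powers of `z` at indices of equal iterates agree if `z` is a root of unity of order
dividing the period. -/
theorem pow_eq_pow_of_iterEq {x : X} {z : Circle} (hz : z ^ S.minPeriod x = 1) {a b : ℕ}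
    (h : S.IterEq a x b x) : z ^ a = z ^ b := by
  wlog hlt : b ≤ a generalizing a b
  · obtain ⟨y, h1, h2⟩ := h
    exact (this ⟨y, h2, h1⟩ (by omega)).symm
  obtain ⟨n, rfl⟩ := Nat.exists_eq_add_of_le hlt
  obtain ⟨c, rfl⟩ := S.minPeriod_dvd h
  rw [pow_add, pow_mul, hz, one_pow, mul_one]

end Periods

theorem eventually_ne_of_tendsto [T2Space X] {ι : Type*} {F : Filter ι} {f g : ι → X} {x y : X}
    (hf : Filter.Tendsto f F (𝓝 x)) (hg : Filter.Tendsto g F (𝓝 y)) (h : x ≠ y) :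
    ∀ᶠ i in F, f i ≠ g i :=
  (hf.prodMk_nhds hg).eventually
    (isClosed_diagonal.isOpen_compl.mem_nhds (show (x, y) ∈ (Set.diagonal X)ᶜ from h))

/-! ### The isotropy that survives along a convergent filter. -/

section LimitIsotropy

variable [T2Space X] (S : SGDS X)

/-- The group of all `k - l` such that `σᵏ` and `σˡ` are defined at `x` and agree eventually. -/
def limitIsotropy {ι : Type*} (F : Filter ι) (f : ι → X) (x : X) [F.NeBot]
    (hf : Filter.Tendsto f F (𝓝 x)) : AddSubgroup ℤ where
  carrier := {n | ∃ k l : ℕ, n = k - l ∧ x ∈ S.dom k ∧ x ∈ S.dom l ∧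
    ∀ᶠ i in F, S.tot^[k] (f i) = S.tot^[l] (f i)}
  zero_mem' := ⟨0, 0, by simp [dom_zero]⟩
  neg_mem' := by
    rintro _ ⟨k, l, rfl, hk, hl, h⟩
    exact ⟨l, k, by ring, hl, hk, h.mono fun _ hi => hi.symm⟩
  add_mem' := by
    rintro _ _ ⟨k, l, rfl, hk, hl, h⟩ ⟨k', l', rfl, hk', hl', h'⟩
    -- Adding indices requires x to lie in the domains of the longer iterates. If k ≠ l, passing to
    -- the limit gives σᵏ(x) = σˡ(x), and then all iterates are defined at x; if k = l, the second
    -- pair already represents the sum.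
    by_cases hkl : k = l
    · exact ⟨k', l', by rw [hkl]; ring, hk', hl', h'⟩
    · have hx : S.tot^[k] x = S.tot^[l] x := by
        have h1 := (S.continuousAt_iterate_tot hk).tendsto.comp hf
        have h2 := (S.continuousAt_iterate_tot hl).tendsto.comp hf
        exact tendsto_nhds_unique (h1.congr' h) h2
      have hd := S.mem_dom_of_iterate_eq hk hl hx hkl
      refine ⟨k + k', l + l', by push_cast; ring, hd _, hd _, ?_⟩
      filter_upwards [h, h'] with i h1 h2
      rw [add_comm k, Function.iterate_add_apply, h1, ← Function.iterate_add_apply, add_comm,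
        Function.iterate_add_apply, h2, ← Function.iterate_add_apply]

-- Membership in the limit isotropy provides some pair (k', l') with the given difference, not the
-- pair (k, l) itself. If k' exceeds k, the surplus iterate is cancelled by local injectivity at
-- σᵏ(x) = σˡ(x); if k exceeds k', the missing iterate is applied to both sides.
variable {S} in
theorem eventually_eq_of_sub_mem_limitIsotropy {ι : Type*} {F : Filter ι} {f : ι → X} {x : X}
    [F.NeBot] {hf : Filter.Tendsto f F (𝓝 x)} {k l : ℕ} (hk : x ∈ S.dom k) (hl : x ∈ S.dom l)
    (h : S.tot^[k] x = S.tot^[l] x) (hm : (k : ℤ) - l ∈ S.limitIsotropy F f x hf) :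
    ∀ᶠ i in F, S.tot^[k] (f i) = S.tot^[l] (f i) := by
  obtain ⟨k', l', hkl, hk', hl', h'⟩ := hm
  rcases le_total k k' with hle | hle
  · obtain ⟨j, rfl⟩ := Nat.exists_eq_add_of_le hle
    obtain rfl : l' = l + j := by push_cast at hkl; omega
    refine S.eventually_eq_of_iterate_eq (n := j) (S.mem_dom_add.1 hk').2
      ((S.continuousAt_iterate_tot hk).tendsto.comp hf) ?_ ?_
    · rw [h]
      exact (S.continuousAt_iterate_tot hl).tendsto.comp hf
    · filter_upwards [h'] with i hi
      rwa [add_comm k, add_comm l, Function.iterate_add_apply, Function.iterate_add_apply] at hi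
  · obtain ⟨j, rfl⟩ := Nat.exists_eq_add_of_le hle
    obtain rfl : l = l' + j := by push_cast at hkl; omega
    filter_upwards [h'] with i hi
    rw [add_comm k', add_comm l', Function.iterate_add_apply, Function.iterate_add_apply, hi]

/-- A limit of points whose preperiod differs from that of a periodic limit point has trivial
limit isotropy. -/
theorem limitIsotropy_eq_bot {ι : Type*} {F : Filter ι} {f : ι → X} {x : X}
    [F.NeBot] {hf : Filter.Tendsto f F (𝓝 x)} (hx : S.IsPeriodic x)
    (h : ∀ᶠ i in F, S.preperiod (f i) ≠ S.preperiod x) : S.limitIsotropy F f x hf = ⊥ := by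
  rw [eq_bot_iff]
  by_contra hcon
  obtain ⟨m, hm, hm0⟩ := SetLike.not_le_iff_exists.1 hcon
  have hm0 : m ≠ 0 := hm0
  obtain ⟨n, hn, hmem⟩ : ∃ n : ℕ, 1 ≤ n ∧ (n : ℤ) ∈ S.limitIsotropy F f x hf := by
    refine ⟨m.natAbs, Int.natAbs_pos.2 hm0, ?_⟩
    rcases Int.natAbs_eq m with h | h
    · rwa [← h]
    · rw [← neg_mem_iff, ← h]
      exact hm
  have hd := hx.mem_dom
  obtain ⟨k, l, hkl, hk, hl, hev⟩ := id hmem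
  obtain rfl : k = l + n := by omega
  have heq : S.tot^[l + n] x = S.tot^[l] x := by
    have h1 := (S.continuousAt_iterate_tot hk).tendsto.comp hf
    have h2 := (S.continuousAt_iterate_tot hl).tendsto.comp hf
    exact tendsto_nhds_unique (h1.congr' hev) h2
  have hdvd := S.minPeriod_dvd (S.iterEq_iff.2 ⟨hk, hl, heq⟩)
  -- A positive n in the limit isotropy is a common multiple of the periods of x and of nearby f i.
  -- The equation at index l(x) passes to f i by cancellation, which bounds the preperiod of f i
  -- from above.
  have hle : ∀ᶠ i in F, S.tot^[S.minPreperiod x + n] (f i) = S.tot^[S.minPreperiod x] (f i) :=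
    eventually_eq_of_sub_mem_limitIsotropy (hd _) (hd _)
      ((S.minPreperiod_le_iff hx hn hdvd).1 le_rfl) (hf := hf) (by
        rwa [show ((S.minPreperiod x + n : ℕ) : ℤ) - (S.minPreperiod x : ℕ) = n by
          push_cast; ring])
  -- For the finitely many j < l(x) the two iterates of x are distinct, and distinctness persists
  -- nearby in a Hausdorff space. This is the bound from below.
  have hge : ∀ᶠ i in F, ∀ j ∈ Finset.range (S.minPreperiod x),
      S.tot^[j + n] (f i) ≠ S.tot^[j] (f i) := by
    rw [Filter.eventually_all_finset]
    intro j hj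
    have h1 := (S.continuousAt_iterate_tot (hd (j + n))).tendsto.comp hf
    have h2 := (S.continuousAt_iterate_tot (hd j)).tendsto.comp hf
    refine eventually_ne_of_tendsto h1 h2 fun h3 => ?_
    have := (S.minPreperiod_le_iff hx hn hdvd).2 h3
    exact absurd (Finset.mem_range.1 hj) (not_lt.2 this)
  obtain ⟨i, h1, h2, h3, h4, h5, h6⟩ := (h.and (hev.and (hle.and (hge.and
    ((hf.eventually ((S.isOpen_dom _).mem_nhds hk)).and (hf.eventually ((S.isOpen_dom _).mem_nhds hl))))))).exists
  have hI : S.IterEq (l + n) (f i) l (f i) := S.iterEq_iff.2 ⟨h5, h6, h2⟩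
  have hp : S.IsPeriodic (f i) := ⟨l, n, hn, hI⟩
  have hdvd' := S.minPeriod_dvd hI
  refine h1 ?_
  rw [preperiod, preperiod, if_pos hp, if_pos hx]
  congr 1
  refine le_antisymm ((S.minPreperiod_le_iff hp hn hdvd').2 h3) (not_lt.1 fun hlt => ?_)
  exact h4 _ (Finset.mem_range.2 hlt) ((S.minPreperiod_le_iff hp hn hdvd').1 le_rfl)

end LimitIsotropy

end SGDS

namespace SGDS

variable {X : Type u} [TopologicalSpace X] [T2Space X] [LocallyCompactSpace X] (S : SGDS X)

/-! ### Matrix coefficients of the orbit representations. -/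

section Coefficients

theorem orbMap_coe (x₀ : X) (y : S.Orb x₀) : (S.orbMap x₀ y : X) = S.tot y := by
  rw [orbMap, tot]
  split_ifs <;> rfl

theorem iterate_orbMap_coe (x₀ : X) (n : ℕ) (y : S.Orb x₀) :
    ((S.orbMap x₀)^[n] y : X) = S.tot^[n] y := by
  induction n with
  | zero => rfl
  | succ n ih => rw [Function.iterate_succ_apply', orbMap_coe, ih, Function.iterate_succ_apply']

theorem orbRep_t0_apply (x₀ : X) (γ : Circle) (f : C₀(X, ℂ)) (v : S.H x₀) (z : S.Orb x₀) :
    S.orbRep x₀ γ (S.univPair.t0 f) v z = f z * v z := rfl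

theorem orbRep_t1_apply (x₀ : X) (γ : Circle) (ξ : C_c(S.U, ℂ)) (v : S.H x₀) (z : S.Orb x₀) :
    S.orbRep x₀ γ (S.univPair.t1 ξ) v z = γ * S.extendZero ξ z * v (S.orbMap x₀ z) := rfl

theorem orbRep_mul_apply (x₀ : X) (γ : Circle) (a b : S.CStar) (v : S.H x₀) :
    S.orbRep x₀ γ (a * b) v = S.orbRep x₀ γ a (S.orbRep x₀ γ b v) := by
  rw [map_mul]
  rfl

theorem orbRep_star_delta_apply (x₀ : X) (γ : Circle) (a : S.CStar) (z y : S.Orb x₀) :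
    S.orbRep x₀ γ (star a) (delta y) z = star (S.orbRep x₀ γ a (delta z) y) := by
  rw [map_star, ← inner_delta_left, ContinuousLinearMap.star_eq_adjoint,
    ContinuousLinearMap.adjoint_inner_right, ← inner_conj_symm, inner_delta_left]
  rfl

theorem orbRep_star_t1_apply (x₀ : X) (γ : Circle) (ξ : C_c(S.U, ℂ)) (v : S.H x₀) (z : S.Orb x₀)
    (s : Finset (S.Orb x₀)) (hs : ∀ y ∈ s, ∃ h : (y : X) ∈ S.U, S.σ ⟨y, h⟩ = z)
    (hs' : ∀ (y : S.Orb x₀) (h : (y : X) ∈ S.U), S.σ ⟨y, h⟩ = z → ξ ⟨y, h⟩ ≠ 0 → y ∈ s) :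
    S.orbRep x₀ γ (star (S.univPair.t1 ξ)) v z =
      star (γ : ℂ) * ∑ y ∈ s, star (S.extendZero ξ y) * v y := by
  rw [map_star, ← inner_delta_left, ContinuousLinearMap.star_eq_adjoint,
    ContinuousLinearMap.adjoint_inner_right]
  have h1 : S.orbRep x₀ γ (S.univPair.t1 ξ) (delta z) =
      (γ : ℂ) • ∑ y ∈ s, S.extendZero ξ y • delta y := S.orbT1_delta x₀ γ ξ z s hs hs'
  rw [h1, inner_smul_left, sum_inner]
  congr 1
  refine Finset.sum_congr rfl fun y _ => ?_
  rw [inner_smul_left, inner_delta_left]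
  rfl

theorem norm_delta {O : Type u} (x : O) : ‖delta x‖ = 1 := by
  classical
  rw [delta, lp.norm_single (by norm_num)]
  exact norm_one

theorem norm_orbRep_delta_apply_le (x₀ : X) (γ : Circle) (a : S.CStar) (z y : S.Orb x₀) :
    ‖S.orbRep x₀ γ a (delta y) z‖ ≤ ‖a‖ := by
  refine (lp.norm_apply_le_norm (by norm_num) _ z).trans ?_
  refine ((S.orbRep x₀ γ a).le_opNorm _).trans ?_
  rw [norm_delta, mul_one]
  exact NonUnitalStarAlgHom.norm_apply_le (S.orbRep x₀ γ) a

/-- The sum over a fibre of `σ` as a sum over the orbit. -/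
theorem fiberSum_eq_sum (x₀ : X) (g : S.U → ℂ) (x : S.Orb x₀) (s : Finset (S.Orb x₀))
    (hs : ∀ y ∈ s, ∃ h : (y : X) ∈ S.U, S.σ ⟨y, h⟩ = x)
    (hs' : ∀ (y : S.Orb x₀) (h : (y : X) ∈ S.U), S.σ ⟨y, h⟩ = x → g ⟨y, h⟩ ≠ 0 → y ∈ s)
    (g' : X → ℂ) (hg' : ∀ y : S.U, g' y = g y) :
    fiberSum S.σ g x = ∑ y ∈ s, g' y := by
  classical
  have hinj : Set.InjOn (Subtype.val : S.U → X) (Subtype.val ⁻¹' ((s.image Subtype.val : Finset X) :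
      Set X)) := Subtype.val_injective.injOn
  have hmem : ∀ y : S.U, y ∈ (s.image Subtype.val).preimage Subtype.val hinj ↔
      ∃ h : (y : X) ∈ S.Orb x₀, (⟨y, h⟩ : S.Orb x₀) ∈ s := by
    intro y
    rw [Finset.mem_preimage, Finset.mem_image]
    constructor
    · rintro ⟨w, hw, hwy⟩
      exact ⟨hwy ▸ w.2, by simpa only [← hwy] using hw⟩
    · rintro ⟨h, hy⟩
      exact ⟨_, hy, rfl⟩
  unfold fiberSum
  rw [finsum_eq_sum_of_support_subset (s := (s.image Subtype.val).preimage Subtype.val hinj)]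
  · refine Finset.sum_bij' (fun y hy => ⟨y, ((hmem y).1 hy).1⟩)
      (fun y hy => ⟨y, (hs y hy).1⟩) (fun y hy => ((hmem y).1 hy).2)
      (fun y hy => (hmem _).2 ⟨y.2, hy⟩) (fun _ _ => rfl) (fun _ _ => rfl) fun y hy => ?_
    obtain ⟨h1, h2⟩ := hs _ ((hmem y).1 hy).2
    rw [finsum_eq_if, if_pos h2, hg']
  · intro y hy
    rw [Function.mem_support, finsum_eq_if] at hy
    split_ifs at hy with h1
    · have hyO : (y : X) ∈ S.Orb x₀ := (S.map_mem_orb_iff y).1 (h1 ▸ x.2)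
      exact Finset.mem_coe.2 ((hmem y).2 ⟨hyO, hs' ⟨y, hyO⟩ y.2 h1 hy⟩)
    · exact absurd rfl hy

end Coefficients

/-! ### Elements with an explicit kernel, and their stability under left multiplication by
generators. -/

section Words

/-- The elements of `C*(Σ)` whose matrix coefficients are given by a kernel
`F(z) conj(G(y))` on the pairs with `σᵏ(z) = σˡ(y)`. -/
def IsWord (a : S.CStar) : Prop :=
  ∃ (k l : ℕ) (F G : C(X, ℂ)), (∀ x, F x ≠ 0 → x ∈ S.dom k) ∧ (∀ x, G x ≠ 0 → x ∈ S.dom l) ∧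
    ∀ (x₀ : X) (γ : Circle) (z y : S.Orb x₀),
      (S.tot^[k] z = S.tot^[l] y → S.orbRep x₀ γ a (delta y) z =
        (γ : ℂ) ^ k * star (γ : ℂ) ^ l * (F z * star (G y))) ∧
      (S.tot^[k] z ≠ S.tot^[l] y → S.orbRep x₀ γ a (delta y) z = 0)

/-- The pointwise product of `ξ ∈ C_c(U)` with a continuous function. -/
def mulRight (ξ : C_c(S.U, ℂ)) (g : C(S.U, ℂ)) : C_c(S.U, ℂ) where
  toFun y := ξ y * g y
  continuous_toFun := ξ.continuous.mul g.continuous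
  hasCompactSupport' := ξ.hasCompactSupport.mul_right

theorem mem_U_of_extendZero_ne_zero {ξ : C_c(S.U, ℂ)} {x : X} (h : S.extendZero ξ x ≠ 0) :
    x ∈ S.U :=
  not_imp_comm.1 (S.extendZero_of_notMem ξ) h

variable {S} in
theorem IsWord.star {a : S.CStar} (ha : S.IsWord a) : S.IsWord (star a) := by
  obtain ⟨k, l, F, G, hF, hG, h⟩ := ha
  refine ⟨l, k, G, F, hG, hF, fun x₀ γ z y => ?_⟩
  rw [orbRep_star_delta_apply]
  refine ⟨fun hzy => ?_, fun hzy => ?_⟩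
  · rw [(h x₀ γ y z).1 hzy.symm]
    simp only [star_mul', star_pow, star_star]
    ring
  · rw [(h x₀ γ y z).2 hzy.symm, star_zero]

variable {S} in
theorem IsWord.smul {a : S.CStar} (ha : S.IsWord a) (c : ℂ) : S.IsWord (c • a) := by
  obtain ⟨k, l, F, G, hF, hG, h⟩ := ha
  refine ⟨k, l, c • F, G, fun x hx => hF x (right_ne_zero_of_mul hx), hG, fun x₀ γ z y => ?_⟩
  have h1 : S.orbRep x₀ γ (c • a) (delta y) z = c * S.orbRep x₀ γ a (delta y) z := by
    rw [map_smul]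
    rfl
  rw [h1]
  refine ⟨fun hzy => ?_, fun hzy => ?_⟩
  · rw [(h x₀ γ z y).1 hzy, ContinuousMap.smul_apply, smul_eq_mul]
    ring
  · rw [(h x₀ γ z y).2 hzy, mul_zero]

theorem isWord_t0 (f : C₀(X, ℂ)) : S.IsWord (S.univPair.t0 f) := by
  refine ⟨0, 0, f.toContinuousMap, 1, by simp [dom_zero], by simp [dom_zero],
    fun x₀ γ z y => ?_⟩
  rw [orbRep_t0_apply, delta_apply]
  refine ⟨fun hzy => ?_, fun hzy => ?_⟩
  · rw [if_pos (Subtype.ext hzy)]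
    simp
  · rw [if_neg fun h => hzy (congrArg Subtype.val h), mul_zero]

theorem isWord_t1 (ξ : C_c(S.U, ℂ)) : S.IsWord (S.univPair.t1 ξ) := by
  refine ⟨1, 0, (S.extendZero ξ).toContinuousMap, 1, fun x hx => ?_, by simp [dom_zero],
    fun x₀ γ z y => ?_⟩
  · rw [mem_dom_succ', dom_zero]
    exact ⟨S.mem_U_of_extendZero_ne_zero hx, trivial⟩
  · rw [orbRep_t1_apply, delta_apply]
    refine ⟨fun hzy => ?_, fun hzy => ?_⟩
    · rw [if_pos (Subtype.ext ((S.orbMap_coe x₀ z).trans hzy))]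
      simp
    · rw [if_neg fun h => hzy ((S.orbMap_coe x₀ z).symm.trans (congrArg Subtype.val h)), mul_zero]

variable {S} in
theorem IsWord.t0_mul {a : S.CStar} (ha : S.IsWord a) (f : C₀(X, ℂ)) :
    S.IsWord (S.univPair.t0 f * a) := by
  obtain ⟨k, l, F, G, hF, hG, h⟩ := ha
  refine ⟨k, l, f.toContinuousMap * F, G, fun x hx => hF x (right_ne_zero_of_mul hx), hG,
    fun x₀ γ z y => ?_⟩
  rw [orbRep_mul_apply, orbRep_t0_apply]
  refine ⟨fun hzy => ?_, fun hzy => ?_⟩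
  · rw [(h x₀ γ z y).1 hzy]
    change _ = _ * (f z * F z * _)
    ring
  · rw [(h x₀ γ z y).2 hzy, mul_zero]

-- The new left weight is ξ · (F ∘ σ). It lies in C_c(U), so its extension by zero is continuous on
-- X although F ∘ σ is defined only on U.
variable {S} in
theorem IsWord.t1_mul {a : S.CStar} (ha : S.IsWord a) (ξ : C_c(S.U, ℂ)) :
    S.IsWord (S.univPair.t1 ξ * a) := by
  obtain ⟨k, l, F, G, hF, hG, h⟩ := ha
  let ξ' := S.mulRight ξ (F.comp ⟨S.σ, S.isLocalHomeomorph.continuous⟩)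
  have hξ' : ∀ y, S.extendZero ξ' y = S.extendZero ξ y * F (S.tot y) := by
    intro y
    by_cases hy : y ∈ S.U
    · have h1 := S.extendZero_coe ξ' ⟨y, hy⟩
      have h2 := S.extendZero_coe ξ ⟨y, hy⟩
      simp only at h1 h2
      rw [h1, h2, S.tot_of_mem hy]
      rfl
    · rw [S.extendZero_of_notMem _ hy, S.extendZero_of_notMem _ hy, zero_mul]
  refine ⟨k + 1, l, (S.extendZero ξ').toContinuousMap, G, fun x hx => ?_, hG, fun x₀ γ z y => ?_⟩
  · have hx : S.extendZero ξ' x ≠ 0 := hx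
    rw [hξ'] at hx
    exact S.mem_dom_succ'.2 ⟨S.mem_U_of_extendZero_ne_zero (left_ne_zero_of_mul hx),
      hF _ (right_ne_zero_of_mul hx)⟩
  · rw [orbRep_mul_apply, orbRep_t1_apply, Function.iterate_succ_apply, ← S.orbMap_coe x₀ z]
    refine ⟨fun hzy => ?_, fun hzy => ?_⟩
    · rw [(h x₀ γ _ y).1 hzy, orbMap_coe]
      change _ = _ * (S.extendZero ξ' z * _)
      rw [hξ']
      ring
    · rw [(h x₀ γ _ y).2 hzy, mul_zero]

/-- The iterate is continuous only on its open domain. At any other point G vanishes, and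
boundedness of b forces the product to tend to 0. -/
theorem continuous_mul_comp_iterate {l : ℕ} {G b : X → ℂ} (hG : Continuous G)
    (hGl : ∀ x, G x ≠ 0 → x ∈ S.dom l) (hb : Continuous b) {C : ℝ} (hC : ∀ x, ‖b x‖ ≤ C) :
    Continuous fun x => G x * b (S.tot^[l] x) := by
  rw [continuous_iff_continuousAt]
  intro x
  by_cases hx : x ∈ S.dom l
  · exact hG.continuousAt.mul (hb.continuousAt.comp (S.continuousAt_iterate_tot hx))
  · have h0 : G x = 0 := not_imp_comm.1 (hGl x) hx
    have h1 : Filter.Tendsto (fun y => ‖G y‖ * C) (𝓝 x) (𝓝 0) := by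
      have := (hG.norm.mul_const C).tendsto x
      rwa [h0, norm_zero, zero_mul] at this
    rw [ContinuousAt, h0, zero_mul]
    refine squeeze_zero_norm (fun y => ?_) h1
    rw [norm_mul]
    gcongr
    exact hC _

-- The adjoint of t¹(ξ) sums over a fibre of σ. For k = 0 the kernel of a lives on the single point
-- σˡ(y), so σ is added on the right and the weight is moved into G. For k + 1 the condition
-- σ^(k+1)(y') = σˡ(y) is constant on the fibre over z, so one σ cancels on the left and the weights
-- are summed over the fibre; the scalars γ̄ and γ cancel too.
variable {S} in
theorem IsWord.star_t1_mul {a : S.CStar} (ha : S.IsWord a) (ξ : C_c(S.U, ℂ)) :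
    S.IsWord (Star.star (S.univPair.t1 ξ) * a) := by
  classical
  obtain ⟨k, l, F, G, hF, hG, h⟩ := ha
  cases k with
  | zero =>
    let b := S.extendZero (S.mulRight ξ ((Star.star F).comp ⟨Subtype.val, continuous_subtype_val⟩))
    have hb : ∀ x, b x = S.extendZero ξ x * Star.star (F x) := by
      intro y
      by_cases hy : y ∈ S.U
      · have h1 := S.extendZero_coe (S.mulRight ξ
          ((Star.star F).comp ⟨Subtype.val, continuous_subtype_val⟩)) ⟨y, hy⟩
        have h2 := S.extendZero_coe ξ ⟨y, hy⟩
        simp only at h1 h2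
        rw [h2]
        exact h1
      · rw [S.extendZero_of_notMem ξ hy, zero_mul]
        exact S.extendZero_of_notMem _ hy
    refine ⟨0, l + 1, 1, ⟨_, S.continuous_mul_comp_iterate G.continuous hG b.continuous
      b.toBCF.norm_coe_le_norm⟩, by simp [dom_zero], fun x hx => ?_, fun x₀ γ z y => ?_⟩
    · have hx : G x * b (S.tot^[l] x) ≠ 0 := hx
      exact S.mem_dom_succ.2 ⟨hG x (left_ne_zero_of_mul hx),
        S.mem_U_of_extendZero_ne_zero (right_ne_zero_of_mul hx)⟩
    · obtain ⟨s, hs, hs'⟩ := S.exists_fiber x₀ ξ z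
      rw [orbRep_mul_apply, S.orbRep_star_t1_apply x₀ γ ξ _ z s hs hs']
      set w := (S.orbMap x₀)^[l] y with hw
      have hwc : (w : X) = S.tot^[l] y := S.iterate_orbMap_coe x₀ l y
      have hwz : w ∈ s → (z : X) = S.tot^[l + 1] y := by
        intro hws
        obtain ⟨hU, h1⟩ := hs w hws
        rw [Function.iterate_succ_apply', ← hwc, S.tot_of_mem hU, h1]
      have hterm : ∀ y' : S.Orb x₀, Star.star (S.extendZero ξ y') * S.orbRep x₀ γ a (delta y) y' =
          if y' = w then Star.star (γ : ℂ) ^ l * Star.star (G y * b w) else 0 := by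
        intro y'
        split_ifs with h1
        · rw [(h x₀ γ y' y).1 (by rw [h1, hwc, Function.iterate_zero, id]), h1, hb, star_mul',
            star_mul', star_star]
          ring
        · rw [(h x₀ γ y' y).2 fun h2 => h1 (Subtype.ext (h2.trans hwc.symm)), mul_zero]
      simp only [hterm, Finset.sum_ite_eq']
      refine ⟨fun hz => ?_, fun hz => ?_⟩
      · have hrhs : (γ : ℂ) ^ 0 * Star.star (γ : ℂ) ^ (l + 1) *
            ((1 : C(X, ℂ)) z * Star.star (G y * b (S.tot^[l] y))) =
            Star.star (γ : ℂ) * (Star.star (γ : ℂ) ^ l * Star.star (G y * b w)) := by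
          rw [ContinuousMap.one_apply, hwc]
          ring
        refine Eq.trans ?_ hrhs.symm
        -- The finite set s contains the points of the fibre where ξ ≠ 0; if it misses w, then b w =
        -- 0 and both sides vanish.
        split_ifs with hws
        · rfl
        · by_cases hbw : b w = 0
          · rw [hbw]
            simp
          · rw [hb] at hbw
            have hU := S.mem_U_of_extendZero_ne_zero (left_ne_zero_of_mul hbw)
            refine absurd (hs' w hU ?_ ?_) hws
            · rw [Function.iterate_zero, id] at hz
              rw [hz, Function.iterate_succ_apply', ← hwc, S.tot_of_mem hU]
            · rw [← S.extendZero_coe ξ]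
              exact left_ne_zero_of_mul hbw
      · rw [if_neg fun hws => hz (hwz hws), mul_zero]
  | succ k =>
    have hcont : Continuous fun y : S.U => Star.star (ξ y) * F y :=
      (continuous_star.comp ξ.continuous).mul (F.continuous.comp continuous_subtype_val)
    have hcs : HasCompactSupport fun y : S.U => Star.star (ξ y) * F y :=
      (ξ.hasCompactSupport.comp_left (g := Star.star) (star_zero ℂ)).mul_right
    refine ⟨k, l, ⟨_, fiberSum_continuous S.isLocalHomeomorph hcont hcs⟩, G, fun x hx => ?_, hG,
      fun x₀ γ z y => ?_⟩
    · by_contra hcon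
      refine hx (finsum_eq_zero_of_forall_eq_zero fun y => ?_)
      rw [finsum_eq_if]
      split_ifs with hy
      · have h0 : F y = 0 := by
          by_contra hne
          refine hcon ?_
          rw [← hy, ← S.tot_of_mem y.2]
          exact (S.mem_dom_succ'.1 (hF _ hne)).2
        change _ * F y = 0
        rw [h0, mul_zero]
      · rfl
    · obtain ⟨s, hs, hs'⟩ := S.exists_fiber x₀ ξ z
      rw [orbRep_mul_apply, S.orbRep_star_t1_apply x₀ γ ξ _ z s hs hs']
      have h1 := S.fiberSum_eq_sum x₀ (fun y : S.U => Star.star (ξ y) * F y) z s hs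
        (fun y' hy' hz hne => hs' y' hy' hz fun h0 => hne (by
          rw [h0, star_zero, zero_mul]))
        (fun y => Star.star (S.extendZero ξ y) * F y) (fun y => by rw [S.extendZero_coe])
      refine ⟨fun hzy => ?_, fun hzy => ?_⟩
      · rw [ContinuousMap.coe_mk, h1, Finset.sum_mul, Finset.mul_sum, Finset.mul_sum]
        refine Finset.sum_congr rfl fun y' hy' => ?_
        obtain ⟨hU, h2⟩ := hs y' hy'
        rw [(h x₀ γ y' y).1 (by rw [Function.iterate_succ_apply, S.tot_of_mem hU, h2, hzy])]
        linear_combination (γ : ℂ) ^ k * Star.star (γ : ℂ) ^ l * Star.star (S.extendZero ξ y') *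
          F y' * Star.star (G y) * star_circle_mul γ
      · rw [Finset.sum_eq_zero, mul_zero]
        intro y' hy'
        obtain ⟨hU, h2⟩ := hs y' hy'
        rw [(h x₀ γ y' y).2 (by rwa [Function.iterate_succ_apply, S.tot_of_mem hU, h2]), mul_zero]

end Words

/-! ### Density of the span of words. -/

section Density

theorem span_word_mul {m : S.CStar} (hm : ∀ a, S.IsWord a → S.IsWord (m * a)) {b : S.CStar}
    (hb : b ∈ Submodule.span ℂ {a | S.IsWord a}) :
    m * b ∈ Submodule.span ℂ {a | S.IsWord a} := by
  induction hb using Submodule.span_induction with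
  | mem x hx => exact Submodule.subset_span (hm x hx)
  | zero => rw [mul_zero]; exact zero_mem _
  | add x y _ _ hx hy => rw [mul_add]; exact add_mem hx hy
  | smul c x _ hx => rw [mul_smul_comm]; exact Submodule.smul_mem _ c hx

/-- The words span a subspace containing all `*`-polynomials in the generators. -/
theorem mem_span_word_of_mem_adjoin {a : S.Ambient}
    (ha : a ∈ NonUnitalStarAlgebra.adjoin ℂ (Set.range S.ambientT0 ∪ Set.range S.ambientT1)) :
    (⟨a, NonUnitalStarSubalgebra.le_topologicalClosure _ ha⟩ : S.CStar) ∈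
      Submodule.span ℂ {a | S.IsWord a} := by
  -- Words are stable under left multiplication by generators, but no product of two arbitrary words
  -- is computed. The induction therefore also carries the stability of the span under left
  -- multiplication by a. It runs over the algebra generated by the generators and their adjoints,
  -- which avoids a case for the adjoint of a general element.
  suffices h : ∃ h : a ∈ S.cstarSubalgebra,
      (⟨a, h⟩ : S.CStar) ∈ Submodule.span ℂ {a | S.IsWord a} ∧
        ∀ b ∈ Submodule.span ℂ {a | S.IsWord a},
          (show S.CStar from ⟨a, h⟩) * b ∈ Submodule.span ℂ {a | S.IsWord a} from
    h.choose_spec.1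
  have ha' : a ∈ NonUnitalAlgebra.adjoin ℂ ((Set.range S.ambientT0 ∪ Set.range S.ambientT1) ∪
      star (Set.range S.ambientT0 ∪ Set.range S.ambientT1)) := ha
  induction ha' using NonUnitalAlgebra.adjoin_induction with
  | mem x hx =>
    rcases hx with (⟨f, rfl⟩ | ⟨ξ, rfl⟩) | (⟨f, hf⟩ | ⟨ξ, hξ⟩)
    · exact ⟨S.ambientT0_mem f, Submodule.subset_span (S.isWord_t0 f),
        fun b hb => S.span_word_mul (fun a ha => ha.t0_mul f) hb⟩
    · exact ⟨S.ambientT1_mem ξ, Submodule.subset_span (S.isWord_t1 ξ),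
        fun b hb => S.span_word_mul (fun a ha => ha.t1_mul ξ) hb⟩
    · obtain rfl : x = star (S.ambientT0 f) := by rw [hf, star_star]
      refine ⟨star_mem (S.ambientT0_mem f), Submodule.subset_span (S.isWord_t0 f).star,
        fun b hb => S.span_word_mul (m := star (S.univPair.t0 f)) (fun a ha => ?_) hb⟩
      rw [← map_star]
      exact ha.t0_mul (star f)
    · obtain rfl : x = star (S.ambientT1 ξ) := by rw [hξ, star_star]
      exact ⟨star_mem (S.ambientT1_mem ξ), Submodule.subset_span (S.isWord_t1 ξ).star,
        fun b hb => S.span_word_mul (m := star (S.univPair.t1 ξ))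
          (fun a ha => ha.star_t1_mul ξ) hb⟩
  | add x y hx hy ihx ihy =>
    obtain ⟨hx, h1, h2⟩ := ihx hx
    obtain ⟨hy, h3, h4⟩ := ihy hy
    refine ⟨add_mem hx hy, add_mem h1 h3, fun b hb => ?_⟩
    have := add_mem (h2 b hb) (h4 b hb)
    rwa [← add_mul] at this
  | zero =>
    refine ⟨zero_mem _, zero_mem _, fun b hb => ?_⟩
    have : (0 : S.CStar) * b ∈ Submodule.span ℂ {a | S.IsWord a} := by
      rw [zero_mul]
      exact zero_mem _
    exact this
  | mul x y hx hy ihx ihy =>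
    obtain ⟨hx, h1, h2⟩ := ihx hx
    obtain ⟨hy, h3, h4⟩ := ihy hy
    refine ⟨mul_mem hx hy, h2 _ h3, fun b hb => ?_⟩
    have := h2 _ (h4 b hb)
    rwa [← mul_assoc] at this
  | smul c x hx ih =>
    obtain ⟨hx, h1, h2⟩ := ih hx
    refine ⟨SMulMemClass.smul_mem c hx, Submodule.smul_mem _ c h1, fun b hb => ?_⟩
    have := Submodule.smul_mem _ c (h2 b hb)
    rwa [← smul_mul_assoc] at this

/-- A closed additive property holding for the words holds on all of `C*(Σ)`. -/
theorem word_induction {p : S.CStar → Prop} (word : ∀ a, S.IsWord a → p a)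
    (add : ∀ a b, p a → p b → p (a + b)) (closed : IsClosed {a | p a}) (a : S.CStar) : p a := by
  have hspan : ∀ b ∈ Submodule.span ℂ {a | S.IsWord a}, p b := by
    intro b hb
    -- The property p is not assumed stable under scalars; since words are, quantifying over c lets
    -- the scalar be absorbed into the word.
    suffices h : ∀ c : ℂ, p (c • b) by simpa using h 1
    induction hb using Submodule.span_induction with
    | mem x hx => exact fun c => word _ (IsWord.smul hx c)
    | zero =>
      intro c
      have h0 := word _ ((S.isWord_t0 0).smul c)
      rwa [map_zero] at h0
    | add x y _ _ hx hy =>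
      intro c
      rw [smul_add]
      exact add _ _ (hx c) (hy c)
    | smul d x _ hx =>
      intro c
      rw [smul_smul]
      exact hx _
  obtain ⟨a, ha⟩ := a
  obtain ⟨s, hs, hlim⟩ := mem_closure_iff_seq_limit.1 ha
  have hlim' : Filter.Tendsto
      (fun n => (⟨s n, NonUnitalStarSubalgebra.le_topologicalClosure _ (hs n)⟩ : S.CStar))
      Filter.atTop (𝓝 ⟨a, ha⟩) := tendsto_subtype_rng.2 hlim
  exact closed.mem_of_tendsto hlim' (Filter.Eventually.of_forall fun n =>
    hspan _ (S.mem_span_word_of_mem_adjoin (hs n)))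

end Density

end SGDS

namespace SGDS

/-! ### Haar means over closed subgroups of the circle. -/

section Annihilator

/-- The annihilator in the circle of a subgroup of `ℤ`. -/
def annihilator (H : AddSubgroup ℤ) : Subgroup Circle where
  carrier := {z | ∀ n ∈ H, z ^ n = 1}
  one_mem' n _ := one_zpow n
  mul_mem' hz hw n hn := by rw [mul_zpow, hz n hn, hw n hn, one_mul]
  inv_mem' hz n hn := by rw [inv_zpow, hz n hn, inv_one]

theorem isClosed_annihilator (H : AddSubgroup ℤ) : IsClosed (annihilator H : Set Circle) := by
  have : (annihilator H : Set Circle) = ⋂ n ∈ H, {z | z ^ n = 1} := by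
    ext z
    simp [annihilator]
  rw [this]
  exact isClosed_biInter fun n _ => isClosed_eq (continuous_zpow n) continuous_const

theorem exists_mem_annihilator_zpow_ne_one {H : AddSubgroup ℤ} {n : ℤ} (hn : n ∉ H) :
    ∃ z ∈ annihilator H, z ^ n ≠ 1 := by
  obtain ⟨q, rfl⟩ := Int.subgroup_cyclic H
  simp only [AddSubgroup.mem_closure_singleton, smul_eq_mul, not_exists] at hn
  have hpi : (Real.pi : ℝ) ≠ 0 := Real.pi_ne_zero
  by_cases hq : q = 0
  · subst hq
    have hn0 : (n : ℝ) ≠ 0 := by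
      intro h
      exact hn 0 (by rw [mul_zero]; exact_mod_cast h.symm)
    -- For H = 0 every z is admitted; this one has n-th power -1.
    refine ⟨Circle.exp (Real.pi / n), fun m hm => ?_, ?_⟩
    · obtain ⟨c, rfl⟩ := AddSubgroup.mem_closure_singleton.1 hm
      simp
    · rw [← Circle.exp_zsmul, zsmul_eq_mul, mul_div_cancel₀ _ hn0, Ne, Circle.exp_eq_one]
      rintro ⟨m, hm⟩
      have h1 : (1 : ℝ) = m * 2 := by
        apply mul_right_cancel₀ hpi
        linarith
      have h2 : (1 : ℤ) = m * 2 := by exact_mod_cast h1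
      omega
  · have hq0 : (q : ℝ) ≠ 0 := by exact_mod_cast hq
    refine ⟨Circle.exp (2 * Real.pi / q), fun m hm => ?_, ?_⟩
    · obtain ⟨c, rfl⟩ := AddSubgroup.mem_closure_singleton.1 hm
      rw [← Circle.exp_zsmul, zsmul_eq_mul, Circle.exp_eq_one]
      refine ⟨c, ?_⟩
      push_cast [smul_eq_mul]
      field_simp
    · rw [← Circle.exp_zsmul, zsmul_eq_mul, Ne, Circle.exp_eq_one]
      rintro ⟨m, hm⟩
      refine hn m ?_
      have h1 : (m : ℝ) * q = n := by
        field_simp at hm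
        linarith
      exact_mod_cast h1

/-- The character `z ↦ zⁿ` of the circle as a complex function. -/
def character (n : ℤ) : C(Circle, ℂ) :=
  ⟨fun z => ((z ^ n : Circle) : ℂ), continuous_subtype_val.comp (continuous_zpow n)⟩

open MeasureTheory in
/-- The mean over the annihilator of a subgroup `H` of `ℤ`. -/
theorem exists_mean (H : AddSubgroup ℤ) : ∃ Λ : C(Circle, ℂ) →ₗ[ℂ] ℂ, (∀ f, ‖Λ f‖ ≤ ‖f‖) ∧
    (∀ n ∈ H, Λ (character n) = 1) ∧ (∀ n ∉ H, Λ (character n) = 0) ∧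
    ∀ f : C(Circle, ℝ), (∀ z, 0 ≤ f z) → Λ ((⟨_, Complex.continuous_ofReal⟩ : C(ℝ, ℂ)).comp f) = 0 →
      ∀ z ∈ annihilator H, f z = 0 := by
  have hK : CompactSpace (annihilator H) :=
    isCompact_iff_compactSpace.1 (isClosed_annihilator H).isCompact
  let _ : MeasurableSpace (annihilator H) := borel _
  have : BorelSpace (annihilator H) := ⟨rfl⟩
  let μ : Measure (annihilator H) := Measure.haarMeasure ⊤
  have hprob : IsProbabilityMeasure μ := ⟨by
    rw [← TopologicalSpace.PositiveCompacts.coe_top]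
    exact Measure.haarMeasure_self⟩
  have hint : ∀ {f : Circle → ℂ}, Continuous f →
      Integrable (fun z : annihilator H => f z) μ := fun hf =>
    (hf.comp continuous_subtype_val).integrable_of_hasCompactSupport
      (HasCompactSupport.of_compactSpace _)
  refine ⟨{ toFun := fun f => ∫ z : annihilator H, f z ∂μ
            map_add' := fun f g => integral_add (hint f.continuous) (hint g.continuous)
            map_smul' := fun c f => integral_const_mul c _ },
    fun f => ?_, fun n hn => ?_, fun n hn => ?_, fun f hf h0 z hz => ?_⟩
  · have := norm_integral_le_of_norm_le_const (μ := μ) (f := fun z : annihilator H => f z)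
      (Filter.Eventually.of_forall fun z => f.norm_coe_le_norm z)
    simpa using this
  · change ∫ z : annihilator H, (((z : Circle) ^ n : Circle) : ℂ) ∂μ = 1
    have : ∀ z : annihilator H, (((z : Circle) ^ n : Circle) : ℂ) = 1 := fun z => by
      rw [z.2 n hn, Circle.coe_one]
    simp [this]
  · change ∫ z : annihilator H, (((z : Circle) ^ n : Circle) : ℂ) ∂μ = 0
    -- Orthogonality of characters: translation by w multiplies the integral by wⁿ ≠ 1 but leaves it
    -- unchanged.
    obtain ⟨w, hw, hwn⟩ := exists_mem_annihilator_zpow_ne_one hn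
    have h1 := integral_mul_left_eq_self (μ := μ)
      (fun z : annihilator H => (((z : Circle) ^ n : Circle) : ℂ)) ⟨w, hw⟩
    simp only [Subgroup.coe_mul, mul_zpow, Circle.coe_mul] at h1
    rw [integral_const_mul] at h1
    have h2 : ((w ^ n : Circle) : ℂ) ≠ 1 := fun h => hwn (Circle.ext (h.trans Circle.coe_one.symm))
    by_contra hne
    exact h2 (mul_right_cancel₀ hne (h1.trans (one_mul _).symm))
  · have h0 : ∫ z : annihilator H, ((f z : ℝ) : ℂ) ∂μ = 0 := h0
    rw [integral_complex_ofReal, Complex.ofReal_eq_zero] at h0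
    have hc : Continuous fun z : annihilator H => f z := f.continuous.comp continuous_subtype_val
    rw [integral_eq_zero_iff_of_nonneg (f := fun z : annihilator H => f z) (fun z => hf z)
      (hc.integrable_of_hasCompactSupport (HasCompactSupport.of_compactSpace _))] at h0
    -- Haar measure charges every nonempty open set, so a continuous function vanishing almost
    -- everywhere vanishes everywhere.
    exact congrFun ((hc.ae_eq_iff_eq μ continuous_zero).1 h0) ⟨z, hz⟩

end Annihilator

variable {X : Type u} [TopologicalSpace X] [T2Space X] [LocallyCompactSpace X] (S : SGDS X)

/-! ### The vector states and their dependence on γ. -/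

section VectorStates

/-- The vector state of `π_{(x,γ)}` at `δ_x`. -/
def vecState (x : X) (γ : Circle) (a : S.CStar) : ℂ :=
  S.orbRep x γ a (delta ⟨x, S.self_mem_orb x⟩) ⟨x, S.self_mem_orb x⟩

theorem orbRep_add_apply (x₀ : X) (γ : Circle) (a b : S.CStar) (v : S.H x₀) (z : S.Orb x₀) :
    S.orbRep x₀ γ (a + b) v z = S.orbRep x₀ γ a v z + S.orbRep x₀ γ b v z := by
  rw [map_add]
  rfl

theorem orbRep_sub_apply (x₀ : X) (γ : Circle) (a b : S.CStar) (v : S.H x₀) (z : S.Orb x₀) :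
    S.orbRep x₀ γ (a - b) v z = S.orbRep x₀ γ a v z - S.orbRep x₀ γ b v z := by
  rw [map_sub]
  rfl

theorem lipschitzWith_orbRep (x₀ : X) (γ : Circle) (y z : S.Orb x₀) :
    LipschitzWith 1 fun a => S.orbRep x₀ γ a (delta y) z :=
  LipschitzWith.of_dist_le_mul fun a b => by
    rw [dist_eq_norm, dist_eq_norm, ← orbRep_sub_apply, NNReal.coe_one, one_mul]
    exact S.norm_orbRep_delta_apply_le _ _ _ _ _

theorem lipschitzWith_vecState (x : X) (γ : Circle) : LipschitzWith 1 (S.vecState x γ) :=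
  S.lipschitzWith_orbRep x γ _ _

/-- A common Lipschitz constant makes the family equicontinuous. This supplies the closedness needed
to extend convergence from words to all of C*(Σ). -/
theorem isClosed_setOf_tendsto_of_lipschitz {ι E : Type*} [PseudoMetricSpace E] {F : Filter ι}
    {f : ι → E → ℂ} {g : E → ℂ} (hf : ∀ i, LipschitzWith 1 (f i)) (hg : LipschitzWith 1 g) :
    IsClosed {a | Filter.Tendsto (fun i => f i a) F (𝓝 (g a))} :=
  (LipschitzWith.uniformEquicontinuous f 1 hf).equicontinuous.isClosed_setOfPred_tendsto
    hg.continuous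

theorem vecState_add (x : X) (γ : Circle) (a b : S.CStar) :
    S.vecState x γ (a + b) = S.vecState x γ a + S.vecState x γ b :=
  S.orbRep_add_apply x γ a b _ _

variable {S} in
theorem IsWord.exists_vecState {a : S.CStar} (ha : S.IsWord a) : ∃ (k l : ℕ) (g : C(X, ℂ)),
    (∀ x, g x ≠ 0 → x ∈ S.dom k ∧ x ∈ S.dom l) ∧ ∀ x γ,
      (S.tot^[k] x = S.tot^[l] x → S.vecState x γ a = g x * character (k - l) γ) ∧
      (S.tot^[k] x ≠ S.tot^[l] x → S.vecState x γ a = 0) := by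
  obtain ⟨k, l, F, G, hF, hG, h⟩ := ha
  refine ⟨k, l, F * Star.star G, fun x hx => ⟨hF x (left_ne_zero_of_mul hx), hG x ?_⟩, fun x γ => ?_⟩
  · have := right_ne_zero_of_mul hx
    rwa [ContinuousMap.star_apply, star_ne_zero] at this
  · obtain ⟨h1, h2⟩ := h x γ ⟨x, S.self_mem_orb x⟩ ⟨x, S.self_mem_orb x⟩
    refine ⟨fun hx => ?_, h2⟩
    rw [vecState, h1 hx]
    have hc : character (k - l) γ = (γ : ℂ) ^ k * Star.star (γ : ℂ) ^ l := by
      change ((γ ^ ((k : ℤ) - l) : Circle) : ℂ) = _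
      rw [zpow_sub, zpow_natCast, zpow_natCast, Circle.coe_mul, Circle.coe_inv_eq_conj,
        Circle.coe_pow, Circle.coe_pow, map_pow]
      rfl
    rw [hc, ContinuousMap.mul_apply, ContinuousMap.star_apply]
    ring

/-- The diagonal coefficients of an orbit representation are the vector states at the points of
the orbit. -/
theorem orbRep_delta_self (x₀ : X) (γ : Circle) (y : S.Orb x₀) (a : S.CStar) :
    S.orbRep x₀ γ a (delta y) y = S.vecState y γ a := by
  refine S.word_induction (p := fun a => S.orbRep x₀ γ a (delta y) y = S.vecState y γ a)
    (fun a ha => ?_) (fun a b ha hb => ?_) ?_ a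
  · obtain ⟨k, l, F, G, -, -, h⟩ := ha
    obtain ⟨h1, h2⟩ := h x₀ γ y y
    obtain ⟨h3, h4⟩ := h y γ ⟨y, S.self_mem_orb y⟩ ⟨y, S.self_mem_orb y⟩
    by_cases hy : S.tot^[k] (y : X) = S.tot^[l] y
    · exact (h1 hy).trans (h3 hy).symm
    · exact (h2 hy).trans (h4 hy).symm
  · rw [orbRep_add_apply, ha, hb, vecState_add]
  · exact isClosed_eq (S.lipschitzWith_orbRep x₀ γ y y).continuous
      (S.lipschitzWith_vecState y γ).continuous

theorem continuous_vecState (x : X) (a : S.CStar) : Continuous fun γ => S.vecState x γ a := by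
  refine S.word_induction (p := fun a => Continuous fun γ => S.vecState x γ a) (fun a ha => ?_)
    (fun a b ha hb => ?_) ?_ a
  · obtain ⟨k, l, g, -, h⟩ := ha.exists_vecState
    by_cases hx : S.tot^[k] x = S.tot^[l] x
    · simp only [(h x _).1 hx]
      exact continuous_const.mul (character _).continuous
    · simp only [(h x _).2 hx]
      exact continuous_const
  · simp only [vecState_add]
    exact ha.add hb
  · simp only [continuous_iff_continuousAt, Set.ofPred_forall]
    exact isClosed_iInter fun γ => isClosed_setOf_tendsto_of_lipschitz
      (fun γ => S.lipschitzWith_vecState x γ) (S.lipschitzWith_vecState x γ)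

/-- The vector states do not see those rotations which are trivial on the isotropy. -/
theorem vecState_mul_left {x : X} {z : Circle}
    (hz : ∀ a b, S.IterEq a x b x → z ^ a = z ^ b) (γ : Circle) (a : S.CStar) :
    S.vecState x (z * γ) a = S.vecState x γ a := by
  refine S.word_induction (p := fun a => S.vecState x (z * γ) a = S.vecState x γ a)
    (fun a ha => ?_) (fun a b ha hb => ?_) ?_ a
  · obtain ⟨k, l, g, hg, h⟩ := ha.exists_vecState
    by_cases hx : S.tot^[k] x = S.tot^[l] x
    · rw [(h x _).1 hx, (h x _).1 hx]
      by_cases h0 : g x = 0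
      · rw [h0, zero_mul, zero_mul]
      · have h1 := hz k l (S.iterEq_iff.2 ⟨(hg x h0).1, (hg x h0).2, hx⟩)
        congr 1
        change (((z * γ) ^ ((k : ℤ) - l) : Circle) : ℂ) = ((γ ^ ((k : ℤ) - l) : Circle) : ℂ)
        rw [mul_zpow, zpow_sub z, zpow_natCast, zpow_natCast, h1, mul_inv_cancel, one_mul]
    · rw [(h x _).2 hx, (h x _).2 hx]
  · rw [vecState_add, vecState_add, ha, hb]
  · exact isClosed_eq (S.lipschitzWith_vecState x _).continuous
      (S.lipschitzWith_vecState x γ).continuous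

theorem vecState_star_mul_self (x : X) (γ : Circle) (a : S.CStar) :
    S.vecState x γ (star a * a) =
      ((‖S.orbRep x γ a (delta ⟨x, S.self_mem_orb x⟩)‖ ^ 2 : ℝ) : ℂ) := by
  rw [vecState, orbRep_mul_apply, map_star, ← inner_delta_left,
    ContinuousLinearMap.star_eq_adjoint, ContinuousLinearMap.adjoint_inner_right,
    inner_self_eq_norm_sq_to_K]
  push_cast
  rfl

end VectorStates

/-! ### Membership in Y_I in terms of vector states. -/

section Ideals

/-- Functions in `C_c(U)` which are `1` at a point and vanish at the other points of its fibre. -/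
theorem exists_bump (y : S.U) :
    ∃ ξ : C_c(S.U, ℂ), ξ y = 1 ∧ ∀ y', S.σ y' = S.σ y → ξ y' ≠ 0 → y' = y := by
  obtain ⟨W, hWo, hyW, hW⟩ := S.isLocalHomeomorph.isLocallyInjective y
  obtain ⟨f, hf1, hf2, hf3, -⟩ := exists_continuousMap_one_of_isCompact_subset_isOpen
    (isCompact_singleton (x := y)) hWo (Set.singleton_subset_iff.2 hyW)
  refine ⟨⟨⟨fun y => (f y : ℂ), Complex.continuous_ofReal.comp f.continuous⟩,
    (show HasCompactSupport f from hf2).comp_left (g := Complex.ofReal) Complex.ofReal_zero⟩,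
    ?_, fun y' h1 h2 => ?_⟩
  · change (f y : ℂ) = 1
    rw [hf1 rfl]
    exact Complex.ofReal_one
  · have h2 : (f y' : ℂ) ≠ 0 := h2
    exact hW (hf3 (subset_tsupport _ (Complex.ofReal_ne_zero.1 h2))) hyW h1

variable {S} in
/-- The basis vectors annihilated by an ideal form a set invariant under `σ`. -/
theorem orbRep_delta_orbMap_eq_zero_iff (I : TwoSidedIdeal S.CStar) (x₀ : X) (γ : Circle)
    (y : S.Orb x₀) :
    (∀ a ∈ I, S.orbRep x₀ γ a (delta (S.orbMap x₀ y)) = 0) ↔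
      ∀ a ∈ I, S.orbRep x₀ γ a (delta y) = 0 := by
  have hγ : (γ : ℂ) ≠ 0 := Circle.coe_ne_zero γ
  by_cases hy : (y : X) ∈ S.U
  swap
  · have : S.orbMap x₀ y = y := by rw [orbMap, dif_neg hy]
    rw [this]
  have hσ := S.orbMap_of_mem x₀ y hy
  obtain ⟨ξ, h1, h2⟩ := S.exists_bump ⟨y, hy⟩
  have hξ : S.extendZero ξ y = 1 := (S.extendZero_coe ξ ⟨y, hy⟩).trans h1
  constructor
  · intro h a ha
    -- The bump isolates y in its fibre, so t¹(ξ) carries δ_{σ(y)} to γ δ_y. As a t¹(ξ) lies in I,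
    -- it kills δ_{σ(y)}, hence a kills δ_y. The converse uses t¹(ξ)* in the same way.
    have h3 : S.orbRep x₀ γ (S.univPair.t1 ξ) (delta (S.orbMap x₀ y)) = (γ : ℂ) • delta y := by
      have h4 := S.orbT1_delta x₀ γ ξ (S.orbMap x₀ y) {y}
        (fun z hz => by
          rw [Finset.mem_singleton.1 hz]
          exact ⟨hy, hσ.symm⟩)
        (fun z hz hz' hne => by
          have h5 : (⟨z, hz⟩ : S.U) = ⟨y, hy⟩ := h2 ⟨z, hz⟩ (hz'.trans hσ) hne
          exact Finset.mem_singleton.2 (Subtype.ext (congrArg (fun w : S.U => (w : X)) h5)))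
      rw [Finset.sum_singleton, hξ, one_smul] at h4
      exact h4
    have h5 := h _ (I.mul_mem_right a (S.univPair.t1 ξ) ha)
    rw [orbRep_mul_apply, h3, map_smul] at h5
    exact (smul_eq_zero.1 h5).resolve_left hγ
  · intro h a ha
    have h3 : S.orbRep x₀ γ (star (S.univPair.t1 ξ)) (delta y) =
        star (γ : ℂ) • delta (S.orbMap x₀ y) := by
      have h4 := S.star_orbT1_delta x₀ γ ξ y
      rw [hξ, mul_one] at h4
      rw [map_star]
      exact h4
    have h5 := h _ (I.mul_mem_right a (star (S.univPair.t1 ξ)) ha)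
    rw [orbRep_mul_apply, h3, map_smul] at h5
    exact (smul_eq_zero.1 h5).resolve_left (star_ne_zero.2 hγ)

theorem orbRep_delta_iterate_orbMap_eq_zero_iff (I : TwoSidedIdeal S.CStar) (x₀ : X) (γ : Circle)
    (n : ℕ) (y : S.Orb x₀) :
    (∀ a ∈ I, S.orbRep x₀ γ a (delta ((S.orbMap x₀)^[n] y)) = 0) ↔
      ∀ a ∈ I, S.orbRep x₀ γ a (delta y) = 0 := by
  induction n with
  | zero => rfl
  | succ n ih => rw [Function.iterate_succ_apply', orbRep_delta_orbMap_eq_zero_iff, ih]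

/-- Every point of the orbit shares an iterate with x, so annihilation of δ_x spreads up and down
the fibres to all basis vectors. -/
theorem mem_idealSet_iff_delta {I : TwoSidedIdeal S.CStar} {x : X} {γ : Circle} :
    (x, γ) ∈ S.idealSet I ↔
      ∀ a ∈ I, S.orbRep x γ a (delta ⟨x, S.self_mem_orb x⟩) = 0 := by
  constructor
  · intro h a ha
    have h1 : S.orbRep x γ a = 0 := (TwoSidedIdeal.mem_ker _).1 (h ha)
    rw [h1]
    rfl
  · intro h a ha
    refine (TwoSidedIdeal.mem_ker _).2 (ext_delta fun y => ?_)
    obtain ⟨n, m, hnm⟩ := y.2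
    have h1 : (S.orbMap x)^[n] y = (S.orbMap x)^[m] ⟨x, S.self_mem_orb x⟩ := by
      refine Subtype.ext ?_
      rw [iterate_orbMap_coe, iterate_orbMap_coe]
      exact (S.iterEq_iff.1 hnm).2.2
    have h2 := (S.orbRep_delta_iterate_orbMap_eq_zero_iff I x γ n y).1 (by
      rw [h1]
      exact (S.orbRep_delta_iterate_orbMap_eq_zero_iff I x γ m _).2 h)
    exact h2 a ha

theorem mem_idealSet_iff {I : TwoSidedIdeal S.CStar} {x : X} {γ : Circle} :
    (x, γ) ∈ S.idealSet I ↔ ∀ a ∈ I, S.vecState x γ a = 0 := by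
  rw [mem_idealSet_iff_delta]
  constructor
  · intro h a ha
    rw [vecState, h a ha]
    rfl
  · intro h a ha
    -- The state at a*a is ‖π(a)δ_x‖², so its vanishing on I kills the vector itself.
    have h1 := h _ (I.mul_mem_left (star a) a ha)
    rw [vecState_star_mul_self, Complex.ofReal_eq_zero] at h1
    exact norm_eq_zero.1 (pow_eq_zero_iff two_ne_zero |>.1 h1)

variable {S} in
theorem mem_idealSet_of_mem_orb {I : TwoSidedIdeal S.CStar} {x y : X} {γ : Circle}
    (hy : y ∈ S.Orb x) (h : (x, γ) ∈ S.idealSet I) : (y, γ) ∈ S.idealSet I := by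
  refine S.mem_idealSet_iff.2 fun a ha => ?_
  have h1 : S.orbRep x γ a = 0 := (TwoSidedIdeal.mem_ker _).1 (h ha)
  rw [← S.orbRep_delta_self x γ ⟨y, hy⟩ a, h1]
  rfl

theorem mem_orb_comm {x y : X} : y ∈ S.Orb x ↔ x ∈ S.Orb y :=
  ⟨fun ⟨n, m, z, h1, h2⟩ => ⟨m, n, z, h2, h1⟩, fun ⟨n, m, z, h1, h2⟩ => ⟨m, n, z, h2, h1⟩⟩

end Ideals

/-! ### Limits of vector states along ultrafilters. -/

section Limits

/-- The function `z ↦ φ_{(x,γz)}(a)` for the vector states `φ`. -/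
def vecStateMap (x : X) (γ : Circle) (a : S.CStar) : C(Circle, ℂ) :=
  ⟨fun z => S.vecState x (γ * z) a, (S.continuous_vecState x a).comp (continuous_const_mul γ)⟩

theorem lipschitzWith_vecStateMap (x : X) (γ : Circle) : LipschitzWith 1 (S.vecStateMap x γ) :=
  LipschitzWith.of_dist_le_mul fun a b => by
    rw [NNReal.coe_one, one_mul, ContinuousMap.dist_le dist_nonneg]
    intro z
    have := (S.lipschitzWith_vecState x (γ * z)).dist_le_mul a b
    rwa [NNReal.coe_one, one_mul] at this

/-- Along an ultrafilter the vector states converge to a mean of the vector states at the limit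
point. -/
theorem tendsto_vecState {u : Ultrafilter (X × Circle)} {x : X} {γ : Circle}
    (hx : Filter.Tendsto Prod.fst (u : Filter (X × Circle)) (𝓝 x))
    (hγ : Filter.Tendsto Prod.snd (u : Filter (X × Circle)) (𝓝 γ))
    {Λ : C(Circle, ℂ) →ₗ[ℂ] ℂ} (hΛ : ∀ f, ‖Λ f‖ ≤ ‖f‖)
    (h1 : ∀ n ∈ S.limitIsotropy (u : Filter (X × Circle)) Prod.fst x hx, Λ (character n) = 1)
    (h0 : ∀ n ∉ S.limitIsotropy (u : Filter (X × Circle)) Prod.fst x hx, Λ (character n) = 0) (a : S.CStar) :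
    Filter.Tendsto (fun i : X × Circle => S.vecState i.1 i.2 a) u (𝓝 (Λ (S.vecStateMap x γ a))) := by
  refine S.word_induction (p := fun a => Filter.Tendsto (fun i : X × Circle => S.vecState i.1 i.2 a) u
    (𝓝 (Λ (S.vecStateMap x γ a)))) (fun a ha => ?_) (fun a b ha hb => ?_) ?_ a
  · obtain ⟨k, l, g, hg, h⟩ := ha.exists_vecState
    have hgx : Filter.Tendsto (fun i : X × Circle => g i.1) u (𝓝 (g x)) :=
      (g.continuous.tendsto x).comp hx
    have hval : S.tot^[k] x = S.tot^[l] x → S.vecStateMap x γ a =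
        (g x * character (k - l) γ) • character (k - l) := by
      intro hkl
      ext z
      change S.vecState x (γ * z) a = g x * character (k - l) γ * character (k - l) z
      rw [(h x _).1 hkl, mul_assoc]
      congr 1
      change (((γ * z) ^ ((k : ℤ) - l) : Circle) : ℂ) = _
      rw [mul_zpow, Circle.coe_mul]
      rfl
    have hval0 : S.tot^[k] x ≠ S.tot^[l] x → S.vecStateMap x γ a = 0 := by
      intro hkl
      ext z
      exact (h x _).2 hkl
    have hnot : (∀ᶠ i in (u : Filter (X × Circle)), S.tot^[k] i.1 ≠ S.tot^[l] i.1) →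
        Filter.Tendsto (fun i : X × Circle => S.vecState i.1 i.2 a) u (𝓝 0) := fun hev =>
      tendsto_const_nhds.congr' (hev.mono fun i hi => ((h i.1 i.2).2 hi).symm)
    -- If g(x) = 0, the iterates need not be defined at x, but |g| bounds the states and tends to 0.
    -- Otherwise x lies in both domains and the limit isotropy decides.
    by_cases hgz : g x = 0
    · have hz : S.vecStateMap x γ a = 0 := by
        by_cases hkl : S.tot^[k] x = S.tot^[l] x
        · rw [hval hkl, hgz, zero_mul, zero_smul]
        · exact hval0 hkl
      rw [hz, map_zero]
      refine squeeze_zero_norm (a := fun i => ‖g i.1‖) (fun i => ?_) ?_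
      · by_cases hkl : S.tot^[k] i.1 = S.tot^[l] i.1
        · rw [(h _ _).1 hkl, norm_mul]
          change _ * ‖((_ : Circle) : ℂ)‖ ≤ _
          rw [Circle.norm_coe, mul_one]
        · rw [(h _ _).2 hkl, norm_zero]
          exact norm_nonneg _
      · have := hgx.norm
        rwa [hgz, norm_zero] at this
    · obtain ⟨hk, hl⟩ := hg x hgz
      by_cases hkl : S.tot^[k] x = S.tot^[l] x
      · rw [hval hkl, map_smul, smul_eq_mul]
        by_cases hm : (k : ℤ) - l ∈ S.limitIsotropy (u : Filter (X × Circle)) Prod.fst x hx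
        · rw [h1 _ hm, mul_one]
          have hev := eventually_eq_of_sub_mem_limitIsotropy hk hl hkl hm
          refine (hgx.mul (((character (k - l)).continuous.tendsto γ).comp hγ)).congr' ?_
          exact hev.mono fun i hi => ((h i.1 i.2).1 hi).symm
        · rw [h0 _ hm, mul_zero]
          refine hnot ?_
          -- Here an ultrafilter is essential: if σᵏ = σˡ does not hold eventually, it eventually
          -- fails.
          exact Ultrafilter.eventually_not.2 fun hev => hm ⟨k, l, rfl, hk, hl, hev⟩
      · rw [hval0 hkl, map_zero]
        exact hnot (eventually_ne_of_tendsto ((S.continuousAt_iterate_tot hk).tendsto.comp hx)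
          ((S.continuousAt_iterate_tot hl).tendsto.comp hx) hkl)
  · have hadd : S.vecStateMap x γ (a + b) = S.vecStateMap x γ a + S.vecStateMap x γ b := by
      ext z
      exact S.vecState_add x _ a b
    simp only [vecState_add, hadd, map_add]
    exact ha.add hb
  · refine isClosed_setOf_tendsto_of_lipschitz (fun i => S.lipschitzWith_vecState i.1 i.2) ?_
    have hΛL : LipschitzWith 1 Λ := LipschitzWith.of_dist_le_mul fun f g => by
      rw [dist_eq_norm, dist_eq_norm, ← map_sub, NNReal.coe_one, one_mul]
      exact hΛ _
    have := hΛL.comp (S.lipschitzWith_vecStateMap x γ)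
    rwa [mul_one] at this

variable {S} in
/-- A limit of points of `Y_I` lies in `Y_I`, together with its translates by the annihilator of
the limit isotropy. -/
theorem mem_idealSet_of_ultrafilter {I : TwoSidedIdeal S.CStar} {u : Ultrafilter (X × Circle)}
    {x : X} {γ : Circle} (hx : Filter.Tendsto Prod.fst (u : Filter (X × Circle)) (𝓝 x))
    (hγ : Filter.Tendsto Prod.snd (u : Filter (X × Circle)) (𝓝 γ)) (hu : S.idealSet I ∈ u)
    {z : Circle} (hz : z ∈ annihilator (S.limitIsotropy (u : Filter (X × Circle)) Prod.fst x hx)) :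
    (x, γ * z) ∈ S.idealSet I := by
  obtain ⟨Λ, hΛ, h1, h0, hpos⟩ := exists_mean (S.limitIsotropy (u : Filter (X × Circle)) Prod.fst x hx)
  refine S.mem_idealSet_iff_delta.2 fun a ha => ?_
  -- Taking a*a makes the averaged function nonnegative, so a zero mean forces it to vanish
  -- pointwise on the annihilator.
  have hlim := S.tendsto_vecState hx hγ hΛ h1 h0 (star a * a)
  have hzero : Filter.Tendsto (fun i : X × Circle => S.vecState i.1 i.2 (star a * a)) u (𝓝 0) :=
    tendsto_const_nhds.congr' (Filter.Eventually.mono hu fun i hi =>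
      (S.mem_idealSet_iff.1 hi _ (I.mul_mem_left (star a) a ha)).symm)
  have hΛ0 := tendsto_nhds_unique hlim hzero
  let f : C(Circle, ℝ) := (⟨_, Complex.continuous_re⟩ : C(ℂ, ℝ)).comp
    (S.vecStateMap x γ (star a * a))
  have hf : ∀ w, f w = ‖S.orbRep x (γ * w) a (delta ⟨x, S.self_mem_orb x⟩)‖ ^ 2 := fun w => by
    change (S.vecState x (γ * w) (star a * a)).re = _
    rw [vecState_star_mul_self, Complex.ofReal_re]
  have hfeq : (⟨_, Complex.continuous_ofReal⟩ : C(ℝ, ℂ)).comp f =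
      S.vecStateMap x γ (star a * a) := by
    ext w
    change ((f w : ℝ) : ℂ) = S.vecState x (γ * w) (star a * a)
    rw [hf, vecState_star_mul_self]
  have h3 := hpos f (fun w => by rw [hf]; positivity) (by rw [hfeq]; exact hΛ0) z hz
  rw [hf] at h3
  exact norm_eq_zero.1 (pow_eq_zero_iff two_ne_zero |>.1 h3)

end Limits

end SGDS

end

/-! ### The conditions for admissibility. -/

theorem mainTheorem6 {X : Type u} [TopologicalSpace X] [T2Space X] [LocallyCompactSpace X]
    (S : SGDS X) (I : TwoSidedIdeal S.CStar) (hI : IsClosed (I : Set S.CStar)) :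
    S.IsAdmissible (S.idealSet I) := by
  have hrot : ∀ {x : X} {z γ : Circle}, (∀ a b, S.IterEq a x b x → z ^ a = z ^ b) →
      ((x, z * γ) ∈ S.idealSet I ↔ (x, γ) ∈ S.idealSet I) := fun hz => by
    simp only [S.mem_idealSet_iff, S.vecState_mul_left hz]
  have hclosed : IsClosed (S.idealSet I) := by
    refine isClosed_of_closure_subset ?_
    rintro ⟨x, γ⟩ h
    obtain ⟨u, hu, hle⟩ := mem_closure_iff_ultrafilter.1 h
    have hx : Filter.Tendsto Prod.fst (u : Filter (X × Circle)) (𝓝 x) :=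
      (continuous_fst.tendsto (x, γ)).mono_left hle
    have hγ : Filter.Tendsto Prod.snd (u : Filter (X × Circle)) (𝓝 γ) :=
      (continuous_snd.tendsto (x, γ)).mono_left hle
    have := SGDS.mem_idealSet_of_ultrafilter hx hγ hu (one_mem _)
    rwa [mul_one] at this
  refine ⟨hclosed, fun x => ?_, fun x₀ hne huniv => ?_⟩
  · have hmem : (x : X) ∈ S.Orb (S.σ x) :=
      S.mem_orb_comm.1 ((S.map_mem_orb_iff x).2 (S.self_mem_orb x))
    ext γ
    exact ⟨SGDS.mem_idealSet_of_mem_orb (S.mem_orb_comm.1 hmem),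
      SGDS.mem_idealSet_of_mem_orb hmem⟩
  · obtain ⟨γ₀, hγ₀⟩ := Set.nonempty_iff_ne_empty.2 hne
    obtain ⟨γ₁, hγ₁⟩ := (Set.ne_univ_iff_exists_notMem _).1 huniv
    have hper : S.IsPeriodic x₀ := by
      by_contra hper
      refine hγ₁ ?_
      -- An aperiodic point has trivial isotropy, so the rotation taking γ₀ to γ₁ preserves
      -- membership.
      have h1 : (x₀, γ₁ * γ₀⁻¹ * γ₀) ∈ S.idealSet I := (hrot fun a b hab => by
        by_cases h : a = b
        · rw [h]
        · exact absurd (S.isPeriodic_of_iterEq hab h) hper).2 hγ₀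
      rwa [inv_mul_cancel_right] at h1
    refine ⟨hper, ?_, ?_⟩
    · ext γ
      rw [Set.mem_smul_set_iff_inv_smul_mem, smul_eq_mul]
      refine hrot fun a b hab => S.pow_eq_pow_of_iterEq ?_ hab
      rw [inv_pow, SGDS.zeta_pow (S.minPeriod_pos hper), inv_one]
    · by_contra hcon
      push Not at hcon
      let A : Set (X × Circle) := {i | S.preperiod i.1 ≠ S.preperiod x₀ ∧ i ∈ S.idealSet I}
      have hx₀ : x₀ ∈ closure (Prod.fst '' A) := by
        rw [mem_closure_iff_nhds]
        intro V hV
        obtain ⟨x, hxV, hx, hne⟩ := hcon V hV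
        obtain ⟨γ, hγ⟩ := hne
        exact ⟨x, hxV, (x, γ), ⟨hx, hγ⟩, rfl⟩
      -- Compactness of 𝕋 makes the projection to X closed, which provides a limit value γ above x₀.
      obtain ⟨⟨_, γ⟩, h, rfl⟩ := closure_minimal (Set.image_mono subset_closure)
        (isClosedMap_fst_of_compactSpace _ isClosed_closure) hx₀
      obtain ⟨u, hu, hle⟩ := mem_closure_iff_ultrafilter.1 h
      have hx : Filter.Tendsto Prod.fst (u : Filter (X × Circle)) _ :=
        (continuous_fst.tendsto _).mono_left hle
      have hγ : Filter.Tendsto Prod.snd (u : Filter (X × Circle)) _ :=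
        (continuous_snd.tendsto _).mono_left hle
      have hbot : S.limitIsotropy (u : Filter (X × Circle)) Prod.fst _ hx = ⊥ :=
        S.limitIsotropy_eq_bot hper (Filter.mem_of_superset (x := A) hu fun i hi => hi.1)
      -- The annihilator of the trivial group is all of 𝕋, so γ can be rotated to the missing value
      -- γ₁.
      have h1 := SGDS.mem_idealSet_of_ultrafilter (z := γ⁻¹ * γ₁) hx hγ
        (Filter.mem_of_superset hu fun i hi => hi.2) (by
          rw [hbot]
          intro n hn
          rw [AddSubgroup.mem_bot.1 hn, zpow_zero])
      rw [mul_inv_cancel_left] at h1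
      exact hγ₁ h1
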